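/- Let $\mu>-\tfrac12$ be real, let $l\ge 0$ be an integer, and write $\|v\|_{\omega}=\bigl(\int_{\mathbb R}|v(x)|^2|x|^{2\mu}\,dx\bigr)^{1/2}$ and $L^2_\omega=L^2(\mathbb R,|x|^{2\mu}dx)$ (complex valued). For $\beta>0$ and an integer $n\ge 0$ let $\widehat\Pi_n^{(\mu,\beta)}$ be the orthogonal projection of $L^2_\omega$ onto the space $\{e^{-\beta^2x^2/2}p(x): p \text{ a polynomial of degree at most } n\}$ (equivalently, the truncation of the expansion in scaled generalized Hermite functions to its first $n+1$ terms). There is a constant $C$ depending only on $\mu$ and $l$ such that the following holds for all $\beta>0$, $A\ge 0$, $u\in L^2_\omega$, all measurable $f$ and all integers $N\ge 1$. Suppose that $$\bigl\|u-\widehat\Pi_n^{(\mu,\beta)}u\bigr\|_{\omega}\le A\Bigl(\int_n^{\infty}|f(x)|^2\,dx\Bigr)^{1/2}\qquad\text{for all integers } n\ge N .$$ Then $$\bigl\|\partial_x^l\bigl(u-\widehat\Pi_N^{(\mu,\beta)}u\bigr)\bigr\|_{\omega}\le C\,A\,\beta^l\Bigl(\int_N^{\infty}|f(x)|^2x^l\,dx\Bigr)^{1/2}.$$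 Here $\partial_x^l$ is the $l$-th weak derivative on $\mathbb R\setminus\{0\}$. Whenever $\int_N^\infty|f(x)|^2x^l\,dx<\infty$, this derivative of $u-\widehat\Pi_N^{(\mu,\beta)}u$ exists as a locally integrable function on $\mathbb R\setminus\{0\}$, and if moreover $\mu<\tfrac12$ it is also the weak derivative on the whole line $\mathbb R$. -/

import Mathlib

open MeasureTheory Set
open scoped ENNReal NNReal

noncomputable section

/-- The measure `|x|^{2μ} dx` on the real line. -/
def weight (μ : ℝ) : Measure ℝ :=
  volume.withDensity fun x => ENNReal.ofReal (|x| ^ (2 * μ))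

/-- The space of (classes of) functions `e^{-β²x²/2} p(x)`, `p` a complex polynomial of degree at
most `N`, inside `L²(|x|^{2μ} dx)`. For `μ > -1/2` and `β ≠ 0` every such function belongs to
`L²(|x|^{2μ} dx)`. -/
def hermiteSpace (μ β : ℝ) (N : ℕ) : Submodule ℂ (Lp ℂ 2 (weight μ)) where
  carrier := {φ | ∃ p ∈ Polynomial.degreeLE ℂ (N : WithBot ℕ),
    φ =ᵐ[weight μ] fun x : ℝ => (Real.exp (-(β ^ 2 * x ^ 2) / 2) : ℂ) * p.eval (x : ℂ)}
  zero_mem' := ⟨0, Submodule.zero_mem _, by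
    filter_upwards [Lp.coeFn_zero ℂ 2 (weight μ)] with x hx
    rw [hx]
    simp⟩
  add_mem' := by
    rintro φ ψ ⟨p, hp, hφ⟩ ⟨q, hq, hψ⟩
    refine ⟨p + q, Submodule.add_mem _ hp hq, ?_⟩
    filter_upwards [Lp.coeFn_add φ ψ, hφ, hψ] with x h₁ h₂ h₃
    rw [h₁, Pi.add_apply, h₂, h₃, Polynomial.eval_add, mul_add]
  smul_mem' := by
    rintro c φ ⟨p, hp, hφ⟩
    refine ⟨c • p, Submodule.smul_mem _ c hp, ?_⟩
    filter_upwards [Lp.coeFn_smul c φ, hφ] with x h₁ h₂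
    rw [h₁, Pi.smul_apply, h₂, Polynomial.eval_smul, smul_eq_mul, smul_eq_mul]
    ring

instance hermiteSpace_finiteDimensional (μ β : ℝ) (N : ℕ) :
    FiniteDimensional ℂ (hermiteSpace μ β N) := by
  let w : Polynomial ℂ → ℝ → ℂ :=
    fun p x => (Real.exp (-(β ^ 2 * x ^ 2) / 2) : ℂ) * p.eval (x : ℂ)
  have hadd : ∀ p q, w (p + q) = w p + w q := by
    intro p q; ext x; simp [w, mul_add]
  have hsmul : ∀ (c : ℂ) p, w (c • p) = c • w p := by
    intro c p; ext x; simp [w]; ring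
  have h0 : w 0 = 0 := by ext x; simp [w]
  let T : Submodule ℂ (Polynomial ℂ) :=
    { carrier := {p | p ∈ Polynomial.degreeLT ℂ (N + 1) ∧ MemLp (w p) 2 (weight μ)}
      zero_mem' := ⟨Submodule.zero_mem _, by rw [h0]; exact MemLp.zero⟩
      add_mem' := fun {p q} hp hq =>
        ⟨Submodule.add_mem _ hp.1 hq.1, by rw [hadd]; exact hp.2.add hq.2⟩
      smul_mem' := fun c p hp =>
        ⟨Submodule.smul_mem _ c hp.1, by rw [hsmul]; exact hp.2.const_smul c⟩ }
  have : FiniteDimensional ℂ (Polynomial.degreeLT ℂ (N + 1)) :=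
    (Polynomial.degreeLTEquiv ℂ (N + 1)).symm.finiteDimensional
  have : FiniteDimensional ℂ T :=
    Submodule.finiteDimensional_of_le (S₂ := Polynomial.degreeLT ℂ (N + 1)) fun p hp => hp.1
  let L : T →ₗ[ℂ] Lp ℂ 2 (weight μ) :=
    { toFun := fun p => p.2.2.toLp (w p)
      map_add' := fun p q => by
        rw [← MemLp.toLp_add]
        exact MemLp.toLp_congr _ _ (by rw [Submodule.coe_add, hadd])
      map_smul' := fun c p => by
        rw [RingHom.id_apply, ← MemLp.toLp_const_smul]
        exact MemLp.toLp_congr _ _ (by rw [Submodule.coe_smul, hsmul]) }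
  refine Submodule.finiteDimensional_of_le (S₂ := LinearMap.range L) ?_
  rintro φ ⟨p, hp, hφ⟩
  have hm : MemLp (w p) 2 (weight μ) := (memLp_congr_ae hφ).1 (Lp.memLp φ)
  have hp' : p ∈ Polynomial.degreeLT ℂ (N + 1) :=
    Polynomial.mem_degreeLT.2 (lt_of_le_of_lt (Polynomial.mem_degreeLE.1 hp)
      (by exact_mod_cast Nat.lt_succ_self N))
  refine ⟨⟨p, hp', hm⟩, ?_⟩
  exact Lp.ext (hm.coeFn_toLp.trans hφ.symm)

/-- The scaled generalized Hermite projection: the orthogonal projection of `L²(|x|^{2μ} dx)`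
onto `hermiteSpace μ β N`. -/
def hermiteProj (μ β : ℝ) (N : ℕ) (u : Lp ℂ 2 (weight μ)) : Lp ℂ 2 (weight μ) :=
  (hermiteSpace μ β N).starProjection u

/-- `g` is the `l`-th weak (distributional) derivative of `v` on the open set `Ω`. -/
def HasWeakDeriv (Ω : Set ℝ) (l : ℕ) (v g : ℝ → ℂ) : Prop :=
  LocallyIntegrableOn v Ω ∧ LocallyIntegrableOn g Ω ∧
    ∀ φ : ℝ → ℂ, ContDiff ℝ (⊤ : ℕ∞) φ → HasCompactSupport φ → tsupport φ ⊆ Ω →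
      ∫ x, v x * iteratedDeriv l φ x = (-1) ^ l * ∫ x, g x * φ x

end

noncomputable section

/-! The truncation error is the sum of the increments of the projections beyond `N`. These are
mutually orthogonal, one on each Hermite level, and by Pythagoras the squared norm of an increment
is the drop of the squared error (`norm_hermiteProj_succ_sub_sq`). An inverse inequality,
`IsHermiteEmbedding.norm_gaussDeriv_pow_sum_sq_le`, bounds the squared norm of the `l`-th derivative
of a sum of levels by `β^(2l) ∑ (n+1)^l ‖h_n‖²` up to a constant. Summation by parts
(`ofReal_abel_sum_le`) then trades the weights `(n+1)^l` and the assumed tail bounds for a factor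
`x^l` under the integral.

For `μ ≠ 0` the ordinary derivative does not fit the levels, but the Dunkl operator does: on
Gaussian times polynomial it is half the difference of a lowering operator and its adjoint raising
operator. Each moves by one level, and their commutator (`dunkl_dunklAdjoint`) bounds their squared
norms on level `n` by `O(β² (n+1))`. A Hardy-type inequality, `norm_gaussDeriv_pow_succ_le`, returns
to the ordinary derivative; it rests on `μ + 1/2 > 0`. All of this is algebra on polynomials, and
the measure enters only through a two-step recurrence of its moments.

In the limit, the derivatives of the partial sums converge in the weighted `L²`. Pairing with a test
function is continuous there, so the limit is a weak derivative, and uniqueness of weak derivatives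
carries the bound to any other one. -/

/-! ### The weighted measure and its Gaussian moments. -/

theorem weight_absolutelyContinuous (μ : ℝ) : weight μ ≪ volume :=
  withDensity_absolutelyContinuous _ _

theorem measurable_abs_rpow (s : ℝ) : Measurable fun x : ℝ => |x| ^ s := by
  fun_prop

theorem volume_absolutelyContinuous_weight (μ : ℝ) : volume ≪ weight μ := by
  refine withDensity_absolutelyContinuous' (by fun_prop) ?_
  filter_upwards [Measure.ae_ne volume (0 : ℝ)] with x hx
  have : 0 < |x| ^ (2 * μ) := Real.rpow_pos_of_pos (abs_pos.2 hx) _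
  simpa using this

theorem integrable_weight_iff {μ : ℝ} {g : ℝ → ℂ} :
    Integrable g (weight μ) ↔ Integrable (fun x => (|x| ^ (2 * μ) : ℝ) • g x) := by
  rw [weight, integrable_withDensity_iff_integrable_smul' (by fun_prop) (by simp)]
  refine integrable_congr (Filter.Eventually.of_forall fun x => ?_)
  simp only
  rw [ENNReal.toReal_ofReal (by positivity)]

theorem integral_weight (μ : ℝ) (g : ℝ → ℂ) :
    ∫ x, g x ∂weight μ = ∫ x, (|x| ^ (2 * μ) : ℝ) • g x := by
  rw [weight, integral_withDensity_eq_integral_toReal_smul (by fun_prop) (by simp)]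
  refine integral_congr_ae (Filter.Eventually.of_forall fun x => ?_)
  simp only
  rw [ENNReal.toReal_ofReal (by positivity)]

theorem integrable_comp_abs_of_integrableOn_Ioi {f : ℝ → ℝ} (hf : IntegrableOn f (Ioi 0)) :
    Integrable fun x => f |x| := by
  have h : IntegrableOn (fun x => f |x|) (Ioi 0) :=
    hf.congr_fun (fun x hx => by rw [abs_of_pos hx]) measurableSet_Ioi
  rw [← integrableOn_univ, ← @Iio_union_Ici _ _ (0 : ℝ), integrableOn_union,
    integrableOn_Ici_iff_integrableOn_Ioi]
  refine ⟨?_, h⟩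
  rw [← (Measure.measurePreserving_neg (volume : Measure ℝ)).integrableOn_comp_preimage
      (Homeomorph.neg ℝ).measurableEmbedding]
  simpa only [Function.comp_def, abs_neg, neg_preimage, neg_Iio, neg_zero] using h

/-- The moments of the measure `|x|^{2μ} e^{-β²x²} dx`. -/
def hermiteMoment (μ β : ℝ) (k : ℕ) : ℝ :=
  ∫ x : ℝ, |x| ^ (2 * μ) * (x ^ k * Real.exp (-(β ^ 2 * x ^ 2)))

theorem rpow_mul_pow_mul {μ : ℝ} (k : ℕ) (c : ℝ) {x : ℝ} (hx : 0 < x) :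
    x ^ (2 * μ) * (x ^ k * c) = x ^ (2 * μ + k) * c := by
  rw [Real.rpow_add hx, Real.rpow_natCast, mul_assoc]

theorem integrableOn_moment {μ β : ℝ} (hμ : -(1 / 2) < μ) (hβ : 0 < β) (k : ℕ) :
    IntegrableOn (fun x : ℝ => x ^ (2 * μ) * (x ^ k * Real.exp (-(β ^ 2 * x ^ 2)))) (Ioi 0) := by
  have h := integrableOn_rpow_mul_exp_neg_mul_sq (b := β ^ 2) (by positivity)
    (s := 2 * μ + k) (by have : (0 : ℝ) ≤ k := k.cast_nonneg; linarith)
  refine h.congr_fun (fun x hx => ?_) measurableSet_Ioi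
  simp only
  rw [rpow_mul_pow_mul k _ hx, neg_mul]

theorem integrable_moment {μ β : ℝ} (hμ : -(1 / 2) < μ) (hβ : 0 < β) (k : ℕ) :
    Integrable fun x : ℝ => |x| ^ (2 * μ) * (x ^ k * Real.exp (-(β ^ 2 * x ^ 2))) := by
  have h := integrable_comp_abs_of_integrableOn_Ioi (integrableOn_moment hμ hβ k)
  refine h.mono' (by fun_prop) (Filter.Eventually.of_forall fun x => ?_)
  simp only [norm_mul, norm_pow, Real.norm_eq_abs, sq_abs, Real.abs_exp]
  rw [abs_of_nonneg (by positivity : (0 : ℝ) ≤ |x| ^ (2 * μ))]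

theorem hermiteMoment_of_odd {μ β : ℝ} {k : ℕ} (hk : Odd k) : hermiteMoment μ β k = 0 := by
  have h := integral_neg_eq_self
    (fun x : ℝ => |x| ^ (2 * μ) * (x ^ k * Real.exp (-(β ^ 2 * x ^ 2)))) volume
  simp only [abs_neg, neg_sq, hk.neg_pow, neg_mul, mul_neg, integral_neg] at h
  rw [hermiteMoment]
  linarith

theorem hermiteMoment_of_even {μ β : ℝ} (hμ : -(1 / 2) < μ) (hβ : 0 < β) {k : ℕ} (hk : Even k) :
    hermiteMoment μ β k =
      (β ^ 2) ^ (-(2 * μ + k + 1) / 2) * Real.Gamma ((2 * μ + k + 1) / 2) := by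
  have h := integral_comp_abs
    (f := fun x : ℝ => x ^ (2 * μ) * (x ^ k * Real.exp (-(β ^ 2 * x ^ 2))))
  simp only [sq_abs, hk.pow_abs] at h
  rw [hermiteMoment, h]
  have h2 := integral_rpow_mul_exp_neg_mul_rpow (p := 2) (q := 2 * μ + k) (b := β ^ 2)
    two_pos (by have : (0 : ℝ) ≤ k := k.cast_nonneg; linarith) (by positivity)
  rw [setIntegral_congr_fun (g := fun x : ℝ => x ^ (2 * μ + k) * Real.exp (-β ^ 2 * x ^ (2 : ℝ)))
    measurableSet_Ioi, h2]
  · ring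
  · intro x hx
    simp only
    rw [rpow_mul_pow_mul k _ hx, neg_mul, Real.rpow_two]

/-- For even `k` this is `Γ(s + 1) = s Γ(s)` at `s = (2μ + k + 1)/2`; for odd `k` both moments
vanish. It encodes integration by parts against the weight, the only analytic input to the inverse
inequality. -/
theorem hermiteMoment_add_two {μ β : ℝ} (hμ : -(1 / 2) < μ) (hβ : 0 < β) (k : ℕ) :
    2 * β ^ 2 * hermiteMoment μ β (k + 2) = (k + 1 + 2 * μ) * hermiteMoment μ β k := by
  rcases Nat.even_or_odd k with hk | hk
  · have hk2 : Even (k + 2) := hk.add (by decide)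
    have hpos : 0 < (2 * μ + k + 1) / 2 := by
      have : (0 : ℝ) ≤ k := k.cast_nonneg
      linarith
    rw [hermiteMoment_of_even hμ hβ hk, hermiteMoment_of_even hμ hβ hk2]
    have e1 : (2 * μ + ((k + 2 : ℕ) : ℝ) + 1) / 2 = (2 * μ + k + 1) / 2 + 1 := by
      push_cast; ring
    have e2 : -(2 * μ + ((k + 2 : ℕ) : ℝ) + 1) / 2 = -(2 * μ + k + 1) / 2 - 1 := by
      push_cast; ring
    have hb : (0 : ℝ) < β ^ 2 := by positivity
    rw [e1, e2, Real.Gamma_add_one hpos.ne', Real.rpow_sub_one hb.ne']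
    field_simp
    ring
  · have hk2 : Odd (k + 2) := hk.add_even (by decide)
    rw [hermiteMoment_of_odd hk, hermiteMoment_of_odd hk2]
    ring

/-! ### Gaussian times polynomial as elements of the weighted `L²`. -/

/-- The function `e^{-β²x²/2} p(x)`. -/
def hermiteFun (β : ℝ) (p : Polynomial ℂ) (x : ℝ) : ℂ :=
  (Real.exp (-(β ^ 2 * x ^ 2) / 2) : ℂ) * p.eval (x : ℂ)

theorem hermiteFun_add (β : ℝ) (p q : Polynomial ℂ) :
    hermiteFun β (p + q) = hermiteFun β p + hermiteFun β q := by
  ext x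
  simp [hermiteFun, mul_add]

theorem hermiteFun_smul (β : ℝ) (c : ℂ) (p : Polynomial ℂ) :
    hermiteFun β (c • p) = c • hermiteFun β p := by
  ext x
  simp [hermiteFun]
  ring

theorem continuous_hermiteFun (β : ℝ) (p : Polynomial ℂ) : Continuous (hermiteFun β p) := by
  unfold hermiteFun
  fun_prop

theorem star_hermiteFun_X_pow_mul (β : ℝ) (a b : ℕ) (x : ℝ) :
    (starRingEnd ℂ) (hermiteFun β (Polynomial.X ^ a) x) * hermiteFun β (Polynomial.X ^ b) x =
      ((x ^ (a + b) * Real.exp (-(β ^ 2 * x ^ 2)) : ℝ) : ℂ) := by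
  have h : Real.exp (-(β ^ 2 * x ^ 2)) =
      Real.exp (-(β ^ 2 * x ^ 2) / 2) * Real.exp (-(β ^ 2 * x ^ 2) / 2) := by
    rw [← Real.exp_add]; ring_nf
  rw [h]
  simp only [hermiteFun, Polynomial.eval_pow, Polynomial.eval_X, map_mul, map_pow,
    Complex.conj_ofReal]
  push_cast
  ring

theorem memLp_hermiteFun {μ β : ℝ} (hμ : -(1 / 2) < μ) (hβ : 0 < β) (p : Polynomial ℂ) :
    MemLp (hermiteFun β p) 2 (weight μ) := by
  induction p using Polynomial.induction_on' with
  | add p q hp hq => rw [hermiteFun_add]; exact hp.add hq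
  | monomial n c =>
    rw [← mul_one c, ← smul_eq_mul c 1, ← Polynomial.smul_monomial, hermiteFun_smul]
    refine MemLp.const_smul ?_ c
    rw [Polynomial.monomial_one_right_eq_X_pow]
    rw [memLp_two_iff_integrable_sq_norm (continuous_hermiteFun _ _).aestronglyMeasurable]
    suffices h : Integrable (fun x => ((‖hermiteFun β (Polynomial.X ^ n) x‖ ^ 2 : ℝ) : ℂ))
        (weight μ) from
      h.re.congr (ae_of_all _ fun x => Complex.ofReal_re _)
    rw [integrable_weight_iff]
    refine (integrable_moment hμ hβ (n + n)).ofReal.congr (Filter.Eventually.of_forall fun x => ?_)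
    have key : (‖hermiteFun β (Polynomial.X ^ n) x‖ ^ 2 : ℝ) =
        x ^ (n + n) * Real.exp (-(β ^ 2 * x ^ 2)) := by
      have h := star_hermiteFun_X_pow_mul β n n x
      rw [mul_comm, Complex.mul_conj, Complex.normSq_eq_norm_sq] at h
      exact_mod_cast h
    simp only
    rw [key, Complex.real_smul]
    exact Complex.ofReal_mul _ _

/-- The class of `e^{-β²x²/2} p(x)` in `L²(|x|^{2μ} dx)`, linearly in `p`. -/
def hermiteMap {μ β : ℝ} (hμ : -(1 / 2) < μ) (hβ : 0 < β) :
    Polynomial ℂ →ₗ[ℂ] Lp ℂ 2 (weight μ) where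
  toFun p := (memLp_hermiteFun hμ hβ p).toLp (hermiteFun β p)
  map_add' p q := by
    rw [← MemLp.toLp_add]
    exact MemLp.toLp_congr _ _ (by rw [hermiteFun_add])
  map_smul' c p := by
    rw [RingHom.id_apply, ← MemLp.toLp_const_smul]
    exact MemLp.toLp_congr _ _ (by rw [hermiteFun_smul])

theorem coeFn_hermiteMap {μ β : ℝ} (hμ : -(1 / 2) < μ) (hβ : 0 < β) (p : Polynomial ℂ) :
    hermiteMap hμ hβ p =ᵐ[weight μ] hermiteFun β p :=
  (memLp_hermiteFun hμ hβ p).coeFn_toLp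

theorem inner_hermiteMap_X_pow {μ β : ℝ} (hμ : -(1 / 2) < μ) (hβ : 0 < β) (a b : ℕ) :
    inner ℂ (hermiteMap hμ hβ (Polynomial.X ^ a)) (hermiteMap hμ hβ (Polynomial.X ^ b)) =
      (hermiteMoment μ β (a + b) : ℂ) := by
  rw [L2.inner_def, hermiteMoment, ← integral_complex_ofReal]
  rw [integral_congr_ae (g := fun x : ℝ =>
    ((x ^ (a + b) * Real.exp (-(β ^ 2 * x ^ 2)) : ℝ) : ℂ)), integral_weight]
  · refine integral_congr_ae (Filter.Eventually.of_forall fun x => ?_)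
    simp only
    rw [Complex.real_smul, ← Complex.ofReal_mul]
  · filter_upwards [coeFn_hermiteMap hμ hβ (Polynomial.X ^ a),
      coeFn_hermiteMap hμ hβ (Polynomial.X ^ b)] with x h₁ h₂
    rw [h₁, h₂, ← star_hermiteFun_X_pow_mul, RCLike.inner_apply, mul_comm]

theorem mem_hermiteSpace_iff {μ β : ℝ} (hμ : -(1 / 2) < μ) (hβ : 0 < β) {n : ℕ}
    {φ : Lp ℂ 2 (weight μ)} :
    φ ∈ hermiteSpace μ β n ↔
      ∃ p ∈ Polynomial.degreeLT ℂ (n + 1), hermiteMap hμ hβ p = φ := by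
  have hdeg : ∀ p : Polynomial ℂ,
      p ∈ Polynomial.degreeLE ℂ (n : WithBot ℕ) ↔ p ∈ Polynomial.degreeLT ℂ (n + 1) := by
    intro p
    rw [Polynomial.mem_degreeLE, Polynomial.mem_degreeLT, ← Polynomial.natDegree_le_iff_degree_le,
      Polynomial.degree_lt_iff_coeff_zero, Polynomial.natDegree_le_iff_coeff_eq_zero]
    rfl
  constructor
  · rintro ⟨p, hp, h⟩
    exact ⟨p, (hdeg p).1 hp, Lp.ext ((coeFn_hermiteMap hμ hβ p).trans h.symm)⟩
  · rintro ⟨p, hp, rfl⟩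
    exact ⟨p, (hdeg p).2 hp, coeFn_hermiteMap hμ hβ p⟩

/-! ### Polynomial algebra of the Dunkl operators. -/

section DunklOperators

open Polynomial

theorem Polynomial.linearMap_ext_X_pow {M : Type*} [AddCommMonoid M] [Module ℂ M]
    {f g : ℂ[X] →ₗ[ℂ] M} (h : ∀ n : ℕ, f (X ^ n) = g (X ^ n)) : f = g := by
  refine Polynomial.lhom_ext' fun n => LinearMap.ext_ring ?_
  simpa [Polynomial.monomial_one_right_eq_X_pow] using h n

/-- Both sides are sesquilinear, so monomials suffice; adjointness relations thereby become
identities between moments. -/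
theorem Polynomial.inner_eq_of_X_pow {E : Type*} [NormedAddCommGroup E] [InnerProductSpace ℂ E]
    {f₁ g₁ f₂ g₂ : ℂ[X] →ₗ[ℂ] E}
    (h : ∀ a b : ℕ, inner ℂ (f₁ (X ^ a)) (g₁ (X ^ b)) = inner ℂ (f₂ (X ^ a)) (g₂ (X ^ b)))
    (p q : ℂ[X]) : inner ℂ (f₁ p) (g₁ q) = inner ℂ (f₂ p) (g₂ q) := by
  induction p using Polynomial.induction_on' with
  | add p p' hp hp' => rw [map_add, map_add, inner_add_left, inner_add_left, hp, hp']
  | monomial a c =>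
    induction q using Polynomial.induction_on' with
    | add q q' hq hq' => rw [map_add, map_add, inner_add_right, inner_add_right, hq, hq']
    | monomial b c' =>
      have e : ∀ (n : ℕ) (z : ℂ), monomial n z = z • (X ^ n : ℂ[X]) := fun n z => by
        rw [← monomial_one_right_eq_X_pow, smul_monomial, smul_eq_mul, mul_one]
      simp only [e, map_smul, inner_smul_left, inner_smul_right, h a b]

/-- The reflection `p(X) ↦ p(-X)`. -/
def reflection : ℂ[X] →ₗ[ℂ] ℂ[X] := (aeval (-X : ℂ[X])).toLinearMap

/-- The operator `p(X) ↦ (p(X) - p(-X)) / (2X)`. -/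
def oddQuotient : ℂ[X] →ₗ[ℂ] ℂ[X] where
  toFun p := (1 / 2 : ℂ) • divX (p - reflection p)
  map_add' p q := by
    rw [map_add, ← smul_add, ← divX_add]
    congr 2
    ring
  map_smul' c p := by
    rw [map_smul, ← smul_sub, smul_eq_C_mul c, divX_C_mul, ← smul_eq_C_mul, RingHom.id_apply,
      smul_comm]

/-- Multiplication by `X`. -/
def mulX : ℂ[X] →ₗ[ℂ] ℂ[X] := LinearMap.mulLeft ℂ X

/-- The Dunkl operator `p ↦ p' + μ (p(X) - p(-X)) / X`. -/
def dunkl (μ : ℝ) : ℂ[X] →ₗ[ℂ] ℂ[X] := derivative + (2 * μ : ℂ) • oddQuotient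

/-- The raising operator, the formal adjoint of `dunkl μ` for the weight `|x|^{2μ} e^{-β²x²}`. -/
def dunklAdjoint (μ β : ℝ) : ℂ[X] →ₗ[ℂ] ℂ[X] := (2 * β ^ 2 : ℂ) • mulX - dunkl μ

/-- The operator on `p` corresponding to the derivative of `e^{-β²x²/2} p(x)`. -/
def gaussDeriv (β : ℝ) : ℂ[X] →ₗ[ℂ] ℂ[X] := derivative - (β ^ 2 : ℂ) • mulX

/-- The operator on `p` corresponding to the Dunkl operator applied to `e^{-β²x²/2} p(x)`. -/
def gaussDunkl (μ β : ℝ) : ℂ[X] →ₗ[ℂ] ℂ[X] := dunkl μ - (β ^ 2 : ℂ) • mulX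

theorem mulX_apply (p : ℂ[X]) : mulX p = X * p := rfl

theorem mulX_X_pow (n : ℕ) : mulX (X ^ n) = X ^ (n + 1) := by
  rw [mulX_apply, pow_succ']

theorem reflection_X_pow (n : ℕ) : reflection (X ^ n) = (-1 : ℂ) ^ n • (X ^ n : ℂ[X]) := by
  simp only [reflection, AlgHom.toLinearMap_apply, map_pow, aeval_X]
  rw [neg_pow, smul_eq_C_mul]
  simp

theorem oddQuotient_apply (p : ℂ[X]) :
    oddQuotient p = (1 / 2 : ℂ) • divX (p - reflection p) := rfl

theorem oddQuotient_X_pow_of_even {n : ℕ} (hn : Even n) : oddQuotient (X ^ n) = 0 := by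
  rw [oddQuotient_apply, reflection_X_pow, hn.neg_one_pow]
  simp

theorem oddQuotient_X_pow_of_odd {n : ℕ} (hn : Odd n) : oddQuotient (X ^ n) = X ^ (n - 1) := by
  have h0 : n ≠ 0 := by rintro rfl; simp at hn
  have e : (X ^ n - (-1 : ℂ) • X ^ n : ℂ[X]) = C 2 * X ^ n := by
    rw [smul_eq_C_mul, ← sub_eq_zero, C_neg, C_1, show (C 2 : ℂ[X]) = 2 from rfl]
    ring
  rw [oddQuotient_apply, reflection_X_pow, hn.neg_one_pow, e, divX_C_mul, divX_X_pow, if_neg h0,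
    ← smul_eq_C_mul, smul_smul]
  norm_num

/-- The coefficient of `dunkl μ (X ^ n)`. -/
def dunklCoeff (μ : ℝ) (n : ℕ) : ℝ := n + if Odd n then 2 * μ else 0

theorem dunkl_X_pow (μ : ℝ) (n : ℕ) :
    dunkl μ (X ^ n) = (dunklCoeff μ n : ℂ) • (X ^ (n - 1) : ℂ[X]) := by
  rw [dunkl, LinearMap.add_apply, LinearMap.smul_apply, derivative_X_pow, dunklCoeff,
    ← smul_eq_C_mul]
  rcases Nat.even_or_odd n with hn | hn
  · rw [oddQuotient_X_pow_of_even hn, if_neg (Nat.not_odd_iff_even.2 hn)]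
    simp
  · rw [oddQuotient_X_pow_of_odd hn, if_pos hn, ← add_smul]
    simp

theorem reflection_reflection (p : ℂ[X]) : reflection (reflection p) = p := by
  have : reflection ∘ₗ reflection = LinearMap.id := linearMap_ext_X_pow fun n => by
    rw [LinearMap.comp_apply, reflection_X_pow, map_smul, reflection_X_pow, smul_smul, ← mul_pow]
    simp
  exact LinearMap.congr_fun this p

theorem two_mul_mulX_oddQuotient (p : ℂ[X]) :
    (2 : ℂ) • mulX (oddQuotient p) = p - reflection p := by
  have : (2 : ℂ) • mulX ∘ₗ oddQuotient = LinearMap.id - reflection :=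
    linearMap_ext_X_pow fun n => by
      simp only [LinearMap.smul_apply, LinearMap.comp_apply, LinearMap.sub_apply,
        LinearMap.id_apply, reflection_X_pow]
      rcases Nat.even_or_odd n with hn | hn
      · rw [oddQuotient_X_pow_of_even hn, hn.neg_one_pow]
        simp
      · have h0 : n - 1 + 1 = n := Nat.sub_add_cancel hn.pos
        rw [oddQuotient_X_pow_of_odd hn, hn.neg_one_pow, mulX_X_pow, h0, neg_smul, one_smul,
          two_smul, sub_neg_eq_add]
  exact LinearMap.congr_fun this p

theorem oddQuotient_mulX_oddQuotient (p : ℂ[X]) :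
    oddQuotient (mulX (oddQuotient p)) = oddQuotient p := by
  have : oddQuotient ∘ₗ mulX ∘ₗ oddQuotient = oddQuotient :=
    linearMap_ext_X_pow fun n => by
      simp only [LinearMap.comp_apply]
      rcases Nat.even_or_odd n with hn | hn
      · rw [oddQuotient_X_pow_of_even hn]
        simp
      · have h0 : n - 1 + 1 = n := Nat.sub_add_cancel hn.pos
        rw [oddQuotient_X_pow_of_odd hn, mulX_X_pow, h0, oddQuotient_X_pow_of_odd hn]
  exact LinearMap.congr_fun this p

theorem reflection_mulX (p : ℂ[X]) : reflection (mulX p) = -mulX (reflection p) := by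
  have : reflection ∘ₗ mulX = -(mulX ∘ₗ reflection) := linearMap_ext_X_pow fun n => by
    simp only [LinearMap.comp_apply, LinearMap.neg_apply, mulX_X_pow, reflection_X_pow, map_smul]
    rw [pow_succ]
    simp
  exact LinearMap.congr_fun this p

theorem reflection_derivative (p : ℂ[X]) :
    reflection (derivative p) = -derivative (reflection p) := by
  have : reflection ∘ₗ derivative = -(derivative ∘ₗ reflection) := linearMap_ext_X_pow fun n => by
    simp only [LinearMap.comp_apply, LinearMap.neg_apply, reflection_X_pow, map_smul,
      derivative_X_pow, ← smul_eq_C_mul]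
    rcases n with _ | n
    · simp
    · rw [pow_succ]
      simp [smul_smul, mul_comm]
  exact LinearMap.congr_fun this p

theorem reflection_oddQuotient (p : ℂ[X]) :
    reflection (oddQuotient p) = oddQuotient p := by
  have : reflection ∘ₗ oddQuotient = oddQuotient := linearMap_ext_X_pow fun n => by
    simp only [LinearMap.comp_apply]
    rcases Nat.even_or_odd n with hn | hn
    · rw [oddQuotient_X_pow_of_even hn]
      simp
    · rw [oddQuotient_X_pow_of_odd hn, reflection_X_pow, (Nat.Odd.sub_odd hn odd_one).neg_one_pow,
        one_smul]
  exact LinearMap.congr_fun this p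

theorem oddQuotient_reflection (p : ℂ[X]) :
    oddQuotient (reflection p) = -oddQuotient p := by
  rw [oddQuotient_apply, oddQuotient_apply, reflection_reflection, ← smul_neg,
    ← neg_sub p (reflection p), ← neg_one_smul ℂ (p - _), smul_eq_C_mul (-1 : ℂ), divX_C_mul,
    ← smul_eq_C_mul, neg_one_smul]

theorem dunkl_apply (μ : ℝ) (p : ℂ[X]) :
    dunkl μ p = derivative p + (2 * μ : ℂ) • oddQuotient p := rfl

theorem dunklAdjoint_apply (μ β : ℝ) (p : ℂ[X]) :
    dunklAdjoint μ β p = (2 * β ^ 2 : ℂ) • mulX p - dunkl μ p := rfl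

theorem gaussDeriv_apply (β : ℝ) (p : ℂ[X]) :
    gaussDeriv β p = derivative p - (β ^ 2 : ℂ) • mulX p := rfl

theorem gaussDunkl_apply (μ β : ℝ) (p : ℂ[X]) :
    gaussDunkl μ β p = gaussDeriv β p + (2 * μ : ℂ) • oddQuotient p := by
  rw [gaussDunkl, LinearMap.sub_apply, dunkl_apply, gaussDeriv_apply, LinearMap.smul_apply]
  abel

/-- Conjugation by the Gaussian turns the Dunkl operator into a difference of ladder operators,
which gives access to norm bounds level by level. -/
theorem two_smul_gaussDunkl (μ β : ℝ) (p : ℂ[X]) :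
    (2 : ℂ) • gaussDunkl μ β p = dunkl μ p - dunklAdjoint μ β p := by
  rw [gaussDunkl, dunklAdjoint]
  simp only [LinearMap.sub_apply, LinearMap.smul_apply]
  module

theorem reflection_gaussDeriv (β : ℝ) (p : ℂ[X]) :
    reflection (gaussDeriv β p) = -gaussDeriv β (reflection p) := by
  rw [gaussDeriv_apply, gaussDeriv_apply, map_sub, map_smul, reflection_mulX,
    reflection_derivative]
  module

theorem reflection_gaussDunkl (μ β : ℝ) (p : ℂ[X]) :
    reflection (gaussDunkl μ β p) = -gaussDunkl μ β (reflection p) := by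
  rw [gaussDunkl_apply, gaussDunkl_apply, map_add, map_smul, reflection_gaussDeriv,
    reflection_oddQuotient, oddQuotient_reflection]
  module

theorem reflection_gaussDeriv_iterate (β : ℝ) (k : ℕ) (p : ℂ[X]) :
    reflection ((gaussDeriv β ^ k) p) = (-1 : ℂ) ^ k • (gaussDeriv β ^ k) (reflection p) := by
  induction k generalizing p with
  | zero => simp
  | succ k ih =>
    rw [pow_succ, Module.End.mul_apply, ih, reflection_gaussDeriv, map_neg, Module.End.mul_apply,
      pow_succ]
    module

theorem gaussDeriv_mulX (β : ℝ) (p : ℂ[X]) :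
    gaussDeriv β (mulX p) = mulX (gaussDeriv β p) + p := by
  simp only [gaussDeriv_apply, mulX_apply, derivative_mul, derivative_X, mul_sub, mul_smul_comm]
  ring

/-- Leibniz rule for a product with `x`, from the commutator of `gaussDeriv β` with `mulX` being the
identity. -/
theorem gaussDeriv_iterate_mulX (β : ℝ) (k : ℕ) (p : ℂ[X]) :
    (gaussDeriv β ^ (k + 1)) (mulX p) =
      mulX ((gaussDeriv β ^ (k + 1)) p) + (k + 1 : ℂ) • (gaussDeriv β ^ k) p := by
  induction k generalizing p with
  | zero => simp [gaussDeriv_mulX]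
  | succ k ih =>
    rw [pow_succ _ (k + 1), Module.End.mul_apply, gaussDeriv_mulX, map_add, ih,
      Module.End.mul_apply]
    rw [← Module.End.mul_apply (gaussDeriv β ^ k), ← pow_succ]
    push_cast
    module

/-- The deformed Heisenberg relation `[D, X] = 1 + 2μR`, where `R` is the reflection: the odd-degree
shift `2μ` in `dunklCoeff` appears with a sign that alternates with the parity of the degree. -/
theorem dunkl_mulX (μ : ℝ) (p : ℂ[X]) :
    dunkl μ (mulX p) = mulX (dunkl μ p) + p + (2 * μ : ℂ) • reflection p := by
  have : dunkl μ ∘ₗ mulX = mulX ∘ₗ dunkl μ + LinearMap.id + (2 * μ : ℂ) • reflection :=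
    linearMap_ext_X_pow fun n => by
      simp only [LinearMap.comp_apply, LinearMap.add_apply, LinearMap.id_apply,
        LinearMap.smul_apply, mulX_X_pow, dunkl_X_pow, reflection_X_pow, map_smul,
        Nat.add_sub_cancel]
      rcases n with _ | n
      · simp [dunklCoeff, add_smul]
      · rw [Nat.add_sub_cancel, smul_smul]
        conv_rhs => enter [1, 2]; rw [← one_smul ℂ (X ^ (n + 1) : ℂ[X])]
        rw [← add_smul, ← add_smul]
        congr 1
        rcases Nat.even_or_odd n with hn | hn
        · have h1 : Odd (n + 1) := hn.add_one
          have h2 : ¬ Odd (n + 1 + 1) := by simpa [Nat.odd_add_one] using h1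
          rw [dunklCoeff, dunklCoeff, if_pos h1, if_neg h2, h1.neg_one_pow]
          push_cast; ring
        · have h1 : Even (n + 1) := hn.add_one
          have h2 : Odd (n + 1 + 1) := h1.add_one
          rw [dunklCoeff, dunklCoeff, if_neg (Nat.not_odd_iff_even.2 h1), if_pos h2,
            h1.neg_one_pow]
          push_cast; ring
  exact LinearMap.congr_fun this p

theorem dunkl_dunklAdjoint (μ β : ℝ) (p : ℂ[X]) :
    dunkl μ (dunklAdjoint μ β p) =
      dunklAdjoint μ β (dunkl μ p) + (2 * β ^ 2 : ℂ) • (p + (2 * μ : ℂ) • reflection p) := by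
  simp only [dunklAdjoint_apply, map_sub, map_smul, dunkl_mulX]
  module

theorem dunkl_mem_degreeLT (μ : ℝ) {n : ℕ} {p : ℂ[X]} (hp : p ∈ degreeLT ℂ (n + 1)) :
    dunkl μ p ∈ degreeLT ℂ n := by
  classical
  rw [degreeLT_eq_span_X_pow] at hp
  induction hp using Submodule.span_induction with
  | mem x hx =>
    simp only [Finset.coe_image, Finset.coe_range, Set.mem_image, Set.mem_Iio] at hx
    obtain ⟨a, ha, rfl⟩ := hx
    rw [dunkl_X_pow]
    rcases a with _ | a
    · simp [dunklCoeff]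
    · refine Submodule.smul_mem _ _ ?_
      rw [mem_degreeLT, Nat.add_sub_cancel, degree_X_pow]
      exact_mod_cast (by omega : a < n)
  | zero => simp
  | add x y _ _ hx hy => rw [map_add]; exact Submodule.add_mem _ hx hy
  | smul c x _ hx => rw [map_smul]; exact Submodule.smul_mem _ _ hx

theorem degreeLT_le_succ (n : ℕ) : degreeLT ℂ n ≤ degreeLT ℂ (n + 1) :=
  degreeLT_mono n.le_succ

theorem mulX_mem_degreeLT {n : ℕ} {p : ℂ[X]} (hp : p ∈ degreeLT ℂ n) :
    mulX p ∈ degreeLT ℂ (n + 1) := by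
  rw [mem_degreeLT, degree_lt_iff_coeff_zero] at hp ⊢
  intro m hm
  obtain ⟨m, rfl⟩ : ∃ k, m = k + 1 := ⟨m - 1, by omega⟩
  rw [mulX_apply, coeff_X_mul]
  exact hp m (by omega)

theorem dunklAdjoint_mem_degreeLT (μ β : ℝ) {n : ℕ} {p : ℂ[X]} (hp : p ∈ degreeLT ℂ n) :
    dunklAdjoint μ β p ∈ degreeLT ℂ (n + 1) := by
  rw [dunklAdjoint_apply]
  exact Submodule.sub_mem _ (Submodule.smul_mem _ _ (mulX_mem_degreeLT hp))
    (degreeLT_le_succ _ (dunkl_mem_degreeLT μ (degreeLT_le_succ _ hp)))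

end DunklOperators

/-! ### Ladder estimates and the inverse inequality. -/

section HermiteEmbedding

open Polynomial

variable {E : Type*} [NormedAddCommGroup E] [InnerProductSpace ℂ E]

/-- A linear map from polynomials to an inner product space that realizes the inner product of
`L²(|x|^{2μ} e^{-β²x²} dx)`, characterized through its moments `m`. -/
structure IsHermiteEmbedding (μ β : ℝ) (m : ℕ → ℝ) (J : ℂ[X] →ₗ[ℂ] E) : Prop where
  inner_X_pow : ∀ a b : ℕ, inner ℂ (J (X ^ a)) (J (X ^ b)) = (m (a + b) : ℂ)
  moment_of_odd : ∀ k, Odd k → m k = 0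
  moment_add_two : ∀ k : ℕ, 2 * β ^ 2 * m (k + 2) = (k + 1 + 2 * μ) * m k

/-- `p` has degree at most `n` and `J p` is orthogonal to the images of lower degree. -/
def IsHermiteLevel (J : ℂ[X] →ₗ[ℂ] E) (n : ℕ) (p : ℂ[X]) : Prop :=
  p ∈ degreeLT ℂ (n + 1) ∧ ∀ q ∈ degreeLT ℂ n, inner ℂ (J q) (J p) = 0

namespace IsHermiteEmbedding

variable {μ β : ℝ} {m : ℕ → ℝ} {J : ℂ[X] →ₗ[ℂ] E}

/-- On `X^a`, `X^b` with `a + b` even, only odd moments occur and everything vanishes. Otherwise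
exactly one exponent is odd, so the two Dunkl coefficients add up to `a + b + 2μ`, the factor in the
moment recurrence. -/
theorem inner_dunkl (hJ : IsHermiteEmbedding μ β m J) (p q : ℂ[X]) :
    inner ℂ (J (dunkl μ p)) (J q) = inner ℂ (J p) (J (dunklAdjoint μ β q)) := by
  refine inner_eq_of_X_pow (f₁ := J ∘ₗ dunkl μ) (f₂ := J) (g₁ := J)
    (g₂ := J ∘ₗ dunklAdjoint μ β) (fun a b => ?_) p q
  have h2β : (starRingEnd ℂ) (dunklCoeff μ a : ℂ) = dunklCoeff μ a := Complex.conj_ofReal _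
  simp only [LinearMap.comp_apply, dunklAdjoint_apply, dunkl_X_pow, mulX_X_pow, map_smul, map_sub,
    inner_smul_left, inner_smul_right, inner_sub_right, hJ.inner_X_pow, h2β]
  suffices h : dunklCoeff μ a * m (a - 1 + b) =
      2 * β ^ 2 * m (a + (b + 1)) - dunklCoeff μ b * m (a + (b - 1)) by exact_mod_cast h
  rcases Nat.even_or_odd (a + b) with hab | hab
  · have h1 : m (a + (b + 1)) = 0 := hJ.moment_of_odd _ (by rw [← add_assoc]; exact hab.add_one)
    rcases a with _ | a <;> rcases b with _ | b
    · simp [dunklCoeff, h1]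
    · have h2 : m b = 0 := hJ.moment_of_odd _ (by
        rw [zero_add, Nat.even_add_one] at hab; exact Nat.not_even_iff_odd.1 hab)
      rw [zero_add] at h1
      simp [dunklCoeff, h1, h2]
    · have h2 : m a = 0 := hJ.moment_of_odd _ (by
        rw [add_zero, Nat.even_add_one] at hab; exact Nat.not_even_iff_odd.1 hab)
      simp [dunklCoeff, h1, h2]
    · have h2 : m (a + 1 + b) = 0 := hJ.moment_of_odd _ (by
        rw [← add_assoc, Nat.even_add_one] at hab; exact Nat.not_even_iff_odd.1 hab)
      have h3 : m (a + (b + 1)) = 0 := by rw [← h2]; congr 1; ring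
      simp [h1, h2, h3]
  · have hc : dunklCoeff μ a + dunklCoeff μ b = a + b + 2 * μ := by
      rcases Nat.even_or_odd a with ha | ha
      · have hb : Odd b := by rwa [Nat.odd_add', iff_true_right ha] at hab
        rw [dunklCoeff, dunklCoeff, if_neg (Nat.not_odd_iff_even.2 ha), if_pos hb]
        ring
      · have hb : Even b := by rwa [Nat.odd_add, iff_true_left ha] at hab
        rw [dunklCoeff, dunklCoeff, if_neg (Nat.not_odd_iff_even.2 hb), if_pos ha]
        ring
    rcases a with _ | a <;> rcases b with _ | b
    · simp at hab
    · have h := hJ.moment_add_two b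
      have h0 : dunklCoeff μ 0 = 0 := by simp [dunklCoeff]
      rw [h0] at hc ⊢
      rw [show 0 + (b + 1 + 1) = b + 2 by ring, h, show 0 + (b + 1 - 1) = b by simp]
      push_cast at hc
      linear_combination m b * hc
    · have h := hJ.moment_add_two a
      have h0 : dunklCoeff μ 0 = 0 := by simp [dunklCoeff]
      rw [h0] at hc ⊢
      rw [show a + 1 + (0 + 1) = a + 2 by ring, h, show a + 1 - 1 + 0 = a by simp]
      push_cast at hc
      linear_combination m a * hc
    · have h := hJ.moment_add_two (a + b + 1)
      rw [show a + 1 + (b + 1 + 1) = a + b + 1 + 2 by ring, h,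
        show a + 1 - 1 + (b + 1) = a + b + 1 by simp; ring,
        show a + 1 + (b + 1 - 1) = a + b + 1 by simp; ring]
      push_cast at hc ⊢
      linear_combination m (a + b + 1) * hc

theorem inner_dunklAdjoint (hJ : IsHermiteEmbedding μ β m J) (p q : ℂ[X]) :
    inner ℂ (J (dunklAdjoint μ β p)) (J q) = inner ℂ (J p) (J (dunkl μ q)) := by
  rw [← inner_conj_symm, ← hJ.inner_dunkl, inner_conj_symm]

/-- Even and odd monomials are orthogonal, so changing the sign of the odd part is an isometry. -/
theorem norm_reflection (hJ : IsHermiteEmbedding μ β m J) (p : ℂ[X]) :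
    ‖J (reflection p)‖ = ‖J p‖ := by
  have h : inner ℂ (J (reflection p)) (J (reflection p)) = inner ℂ (J p) (J p) := by
    refine inner_eq_of_X_pow (f₁ := J ∘ₗ reflection) (g₁ := J ∘ₗ reflection) (f₂ := J) (g₂ := J)
      (fun a b => ?_) p p
    simp only [LinearMap.comp_apply, reflection_X_pow, map_smul, inner_smul_left,
      inner_smul_right, hJ.inner_X_pow, map_pow, map_neg, map_one]
    rw [← mul_assoc, ← pow_add]
    rcases Nat.even_or_odd (a + b) with hab | hab
    · rw [add_comm b a, hab.neg_one_pow, one_mul]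
    · rw [hJ.moment_of_odd _ hab]
      simp
  rw [@norm_eq_sqrt_re_inner ℂ, h, ← @norm_eq_sqrt_re_inner ℂ]

/-- Integration by parts for the Euler operator `x d/dx` against `|x|^{2μ}`: its adjoint is `-x d/dx
- (1 + 2μ)`. On monomials this is again the moment recurrence. -/
theorem inner_mulX_gaussDeriv (hJ : IsHermiteEmbedding μ β m J) (p q : ℂ[X]) :
    inner ℂ (J (mulX (gaussDeriv β p))) (J q) + inner ℂ (J p) (J (mulX (gaussDeriv β q))) =
      -(1 + 2 * μ) * inner ℂ (J p) (J q) := by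
  have h : inner ℂ (J (mulX (gaussDeriv β p)) + (1 + 2 * μ : ℂ) • J p) (J q) =
      inner ℂ (J p) (-J (mulX (gaussDeriv β q))) := by
    refine inner_eq_of_X_pow (f₁ := J ∘ₗ mulX ∘ₗ gaussDeriv β + (1 + 2 * μ : ℂ) • J) (f₂ := J)
      (g₁ := J) (g₂ := -(J ∘ₗ mulX ∘ₗ gaussDeriv β)) (fun a b => ?_) p q
    have e : ∀ n : ℕ, mulX (gaussDeriv β (X ^ n)) =
        (n : ℂ) • (X ^ n : ℂ[X]) - (β ^ 2 : ℂ) • X ^ (n + 2) := by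
      intro n
      rw [gaussDeriv_apply, map_sub, map_smul, mulX_X_pow, mulX_X_pow, derivative_X_pow,
        ← smul_eq_C_mul, map_smul, mulX_X_pow]
      rcases n with _ | n <;> simp
    have h := hJ.moment_add_two (a + b)
    simp only [LinearMap.comp_apply, LinearMap.add_apply, LinearMap.neg_apply,
      LinearMap.smul_apply, e, map_sub, map_smul, inner_add_left, inner_sub_left, inner_smul_left,
      inner_smul_right, inner_neg_right, inner_sub_right, hJ.inner_X_pow, map_add, map_mul, map_pow,
      Complex.conj_ofReal, Complex.conj_natCast, map_one, map_ofNat]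
    suffices h' : a * m (a + b) - β ^ 2 * m (a + 2 + b) + (1 + 2 * μ) * m (a + b) =
        -(b * m (a + b) - β ^ 2 * m (a + (b + 2))) by exact_mod_cast h'
    rw [show a + 2 + b = a + b + 2 by ring, show a + (b + 2) = a + b + 2 by ring]
    push_cast at h
    linear_combination -h
  rw [inner_add_left, inner_smul_left, inner_neg_right] at h
  simp only [map_add, map_mul, Complex.conj_ofReal, map_one, map_ofNat] at h
  linear_combination h

theorem re_inner_mulX_gaussDeriv (hJ : IsHermiteEmbedding μ β m J) (p : ℂ[X]) :
    (inner ℂ (J (mulX (gaussDeriv β p))) (J p)).re = -(μ + 1 / 2) * ‖J p‖ ^ 2 := by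
  have h := congrArg Complex.re (hJ.inner_mulX_gaussDeriv p p)
  rw [← inner_conj_symm (J p) (J (mulX (gaussDeriv β p))), inner_self_eq_norm_sq_to_K] at h
  have e : (-(1 + 2 * μ) * ((‖J p‖ : ℂ)) ^ 2 : ℂ).re = -(1 + 2 * μ) * ‖J p‖ ^ 2 := by
    rw [← Complex.ofReal_re (-(1 + 2 * μ) * ‖J p‖ ^ 2)]
    push_cast
    rfl
  rw [Complex.add_re, Complex.conj_re] at h
  have h' := h.trans e
  linarith

theorem isHermiteLevel_dunkl (hJ : IsHermiteEmbedding μ β m J) {n : ℕ} {p : ℂ[X]}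
    (hp : IsHermiteLevel J (n + 1) p) : IsHermiteLevel J n (dunkl μ p) := by
  refine ⟨dunkl_mem_degreeLT μ hp.1, fun q hq => ?_⟩
  rw [← hJ.inner_dunklAdjoint]
  exact hp.2 _ (dunklAdjoint_mem_degreeLT μ β hq)

theorem isHermiteLevel_dunklAdjoint (hJ : IsHermiteEmbedding μ β m J) {n : ℕ} {p : ℂ[X]}
    (hp : IsHermiteLevel J n p) : IsHermiteLevel J (n + 1) (dunklAdjoint μ β p) := by
  refine ⟨dunklAdjoint_mem_degreeLT μ β hp.1, fun q hq => ?_⟩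
  rw [← hJ.inner_dunkl]
  exact hp.2 _ (dunkl_mem_degreeLT μ hq)

theorem dunkl_eq_zero_of_isHermiteLevel {p : ℂ[X]} (hp : IsHermiteLevel J 0 p) :
    dunkl μ p = 0 := by
  have h := dunkl_mem_degreeLT μ hp.1
  rwa [mem_degreeLT, Nat.cast_zero, Nat.WithBot.lt_zero_iff, degree_eq_bot] at h

/-- Write the left side as the pairing of `p` with `D D* p`, commute to `D* D p`, and bound the
reflection term of the commutator by Cauchy–Schwarz, the reflection being isometric. -/
theorem norm_dunklAdjoint_sq_le (hJ : IsHermiteEmbedding μ β m J) (p : ℂ[X]) :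
    ‖J (dunklAdjoint μ β p)‖ ^ 2 ≤
      ‖J (dunkl μ p)‖ ^ 2 + 2 * β ^ 2 * (1 + 2 * |μ|) * ‖J p‖ ^ 2 := by
  have h : inner ℂ (J (dunklAdjoint μ β p)) (J (dunklAdjoint μ β p)) =
      inner ℂ (J (dunkl μ p)) (J (dunkl μ p)) +
        ((2 * β ^ 2 : ℝ) : ℂ) * (inner ℂ (J p) (J p) +
          ((2 * μ : ℝ) : ℂ) * inner ℂ (J p) (J (reflection p))) := by
    rw [hJ.inner_dunklAdjoint, dunkl_dunklAdjoint, map_add, inner_add_right, ← hJ.inner_dunkl]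
    simp only [map_smul, map_add, inner_smul_right, inner_add_right]
    push_cast
    rfl
  have h1 : (inner ℂ (J p) (J (reflection p))).re ≤ ‖J p‖ ^ 2 ∧
      -‖J p‖ ^ 2 ≤ (inner ℂ (J p) (J (reflection p))).re := by
    have h2 := Complex.abs_re_le_norm (inner ℂ (J p) (J (reflection p)))
    have h3 := norm_inner_le_norm (𝕜 := ℂ) (J p) (J (reflection p))
    rw [hJ.norm_reflection, ← sq] at h3
    exact (abs_le.1 (h2.trans h3)).symm
  have h2 := congrArg Complex.re h
  rw [Complex.add_re, Complex.re_ofReal_mul, Complex.add_re, Complex.re_ofReal_mul] at h2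
  have hn : ∀ v : E, (inner ℂ v v).re = ‖v‖ ^ 2 := fun v => inner_self_eq_norm_sq (𝕜 := ℂ) v
  rw [hn, hn, hn] at h2
  rw [h2]
  have h3 : μ * (inner ℂ (J p) (J (reflection p))).re ≤ |μ| * ‖J p‖ ^ 2 := by
    calc _ ≤ |μ * (inner ℂ (J p) (J (reflection p))).re| := le_abs_self _
      _ = |μ| * |(inner ℂ (J p) (J (reflection p))).re| := abs_mul _ _
      _ ≤ _ := mul_le_mul_of_nonneg_left (abs_le.2 h1.symm) (abs_nonneg _)
  have h4 := mul_le_mul_of_nonneg_left h3 (by positivity : 0 ≤ 4 * β ^ 2)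
  linarith

/-- Duality: lowering from level `n + 1` is adjoint to raising from level `n`, so it inherits the
same bound. Concretely, `‖Dp‖² ≤ ‖p‖ ‖D* D p‖`, and one factor `‖Dp‖` cancels. -/
theorem norm_dunkl_sq_le_of_adjoint (hJ : IsHermiteEmbedding μ β m J) {n : ℕ} {c : ℝ} (hc : 0 ≤ c)
    (h : ∀ q, IsHermiteLevel J n q → ‖J (dunklAdjoint μ β q)‖ ^ 2 ≤ c * ‖J q‖ ^ 2) {p : ℂ[X]}
    (hp : IsHermiteLevel J (n + 1) p) : ‖J (dunkl μ p)‖ ^ 2 ≤ c * ‖J p‖ ^ 2 := by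
  have h1 := h _ (hJ.isHermiteLevel_dunkl hp)
  have h2 : ‖J (dunkl μ p)‖ ^ 2 ≤ ‖J p‖ * ‖J (dunklAdjoint μ β (dunkl μ p))‖ := by
    rw [← inner_self_eq_norm_sq (𝕜 := ℂ), hJ.inner_dunkl]
    exact re_inner_le_norm _ _
  rcases (norm_nonneg (J (dunkl μ p))).eq_or_lt with h0 | h0
  · rw [← h0, zero_pow two_ne_zero]
    positivity
  · have h3 : (‖J (dunkl μ p)‖ ^ 2) ^ 2 ≤ ‖J p‖ ^ 2 * (c * ‖J (dunkl μ p)‖ ^ 2) :=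
      calc _ ≤ (‖J p‖ * ‖J (dunklAdjoint μ β (dunkl μ p))‖) ^ 2 := by gcongr
        _ = ‖J p‖ ^ 2 * ‖J (dunklAdjoint μ β (dunkl μ p))‖ ^ 2 := mul_pow _ _ _
        _ ≤ _ := by gcongr
    refine le_of_mul_le_mul_right ?_ (pow_pos h0 2)
    linarith

/-- Climb the ladder: raising from level `n` gives by duality a bound on lowering from `n + 1`, and
the commutator then bounds raising from `n + 1` at the cost of one more `2β²(1 + 2|μ|)`. Lowering
annihilates level `0`. -/
theorem norm_dunklAdjoint_sq_le_of_level (hJ : IsHermiteEmbedding μ β m J) {n : ℕ} {p : ℂ[X]}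
    (hp : IsHermiteLevel J n p) :
    ‖J (dunklAdjoint μ β p)‖ ^ 2 ≤ (n + 1) * (2 * β ^ 2 * (1 + 2 * |μ|)) * ‖J p‖ ^ 2 := by
  induction n generalizing p with
  | zero =>
    have h := hJ.norm_dunklAdjoint_sq_le p
    rw [dunkl_eq_zero_of_isHermiteLevel hp] at h
    simpa using h
  | succ n ih =>
    have h := hJ.norm_dunklAdjoint_sq_le p
    have h' := hJ.norm_dunkl_sq_le_of_adjoint (by positivity) (fun q hq => ih hq) hp
    push_cast
    linarith

theorem norm_dunkl_sq_le_of_level (hJ : IsHermiteEmbedding μ β m J) {n : ℕ} {p : ℂ[X]}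
    (hp : IsHermiteLevel J (n + 1) p) :
    ‖J (dunkl μ p)‖ ^ 2 ≤ (n + 1) * (2 * β ^ 2 * (1 + 2 * |μ|)) * ‖J p‖ ^ 2 :=
  hJ.norm_dunkl_sq_le_of_adjoint (by positivity)
    (fun _ hq => hJ.norm_dunklAdjoint_sq_le_of_level hq) hp

end IsHermiteEmbedding

theorem norm_sum_sq_of_isHermiteLevel {J : ℂ[X] →ₗ[ℂ] E} {p : ℕ → ℂ[X]}
    (hp : ∀ n, IsHermiteLevel J n (p n)) (M : ℕ) :
    ‖J (∑ n ∈ Finset.range M, p n)‖ ^ 2 = ∑ n ∈ Finset.range M, ‖J (p n)‖ ^ 2 := by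
  induction M with
  | zero => simp
  | succ M ih =>
    have h : inner ℂ (J (∑ n ∈ Finset.range M, p n)) (J (p M)) = 0 := by
      refine (hp M).2 _ (Submodule.sum_mem _ fun n hn => ?_)
      exact degreeLT_mono (Finset.mem_range.1 hn) (hp n).1
    rw [Finset.sum_range_succ, Finset.sum_range_succ, map_add, ← ih, sq, sq, sq,
      norm_add_sq_eq_norm_sq_add_norm_sq_of_inner_eq_zero _ _ h]

theorem isHermiteLevel_zero (J : ℂ[X] →ₗ[ℂ] E) (n : ℕ) : IsHermiteLevel J n 0 :=
  ⟨Submodule.zero_mem _, fun q _ => by simp⟩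

/-- The constant in the inverse inequality for the powers of the Dunkl operator. -/
def dunklConst (μ : ℝ) (l : ℕ) : ℝ := ∏ j ∈ Finset.range l, (1 + 2 * |μ|) * (1 + 2 ^ j)

theorem dunklConst_pos (μ : ℝ) (l : ℕ) : 0 < dunklConst μ l :=
  Finset.prod_pos fun _ _ => by positivity

namespace IsHermiteEmbedding

variable {μ β : ℝ} {m : ℕ → ℝ} {J : ℂ[X] →ₗ[ℂ] E}

/-- Induction on `l` over all level sequences: one application of the operator yields two new
sequences, the lowered and the raised one, each costing a factor of order `β² (n+1)` that increases
the weight exponent by one. -/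
theorem norm_gaussDunkl_pow_sum_sq_le (hJ : IsHermiteEmbedding μ β m J) (l : ℕ) {p : ℕ → ℂ[X]}
    (hp : ∀ n, IsHermiteLevel J n (p n)) (M : ℕ) :
    ‖J ((gaussDunkl μ β ^ l) (∑ n ∈ Finset.range M, p n))‖ ^ 2 ≤
      dunklConst μ l * (β ^ 2) ^ l * ∑ n ∈ Finset.range M, ((n : ℝ) + 1) ^ l * ‖J (p n)‖ ^ 2 := by
  induction l generalizing p M with
  | zero =>
    rw [pow_zero, Module.End.one_apply, norm_sum_sq_of_isHermiteLevel hp]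
    simp [dunklConst]
  | succ l ih =>
    set κ : ℝ := 1 + 2 * |μ| with hκ
    have hκ0 : 0 ≤ κ := by positivity
    set S : ℝ := ∑ n ∈ Finset.range M, ((n : ℝ) + 1) ^ (l + 1) * ‖J (p n)‖ ^ 2 with hS
    set q : ℕ → ℂ[X] := fun n => dunkl μ (p (n + 1)) with hq
    -- Raising leaves level `0` empty, hence the default `0` there and the range `M + 1` below.
    set r : ℕ → ℂ[X] := fun n => n.casesOn 0 fun k => dunklAdjoint μ β (p k) with hr
    have hqL : ∀ n, IsHermiteLevel J n (q n) := fun n => hJ.isHermiteLevel_dunkl (hp (n + 1))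
    have hrL : ∀ n, IsHermiteLevel J n (r n) := by
      rintro (_ | n)
      · exact isHermiteLevel_zero J 0
      · exact hJ.isHermiteLevel_dunklAdjoint (hp n)
    have hqs : ∑ n ∈ Finset.range (M - 1), q n = dunkl μ (∑ n ∈ Finset.range M, p n) := by
      rcases M with _ | M
      · simp
      · rw [Finset.sum_range_succ', map_add, map_sum, dunkl_eq_zero_of_isHermiteLevel (hp 0),
          add_zero, Nat.add_sub_cancel]
    have hrs : ∑ n ∈ Finset.range (M + 1), r n =
        dunklAdjoint μ β (∑ n ∈ Finset.range M, p n) := by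
      rw [Finset.sum_range_succ', map_sum]
      simp [hr]
    have hqb : ∑ n ∈ Finset.range (M - 1), ((n : ℝ) + 1) ^ l * ‖J (q n)‖ ^ 2 ≤
        2 * β ^ 2 * κ * S := by
      have h1 : ∑ n ∈ Finset.range (M - 1), ((n : ℝ) + 1) ^ l * ‖J (q n)‖ ^ 2 ≤
          ∑ n ∈ Finset.range (M - 1),
            2 * β ^ 2 * κ * (((n + 1 : ℕ) : ℝ) + 1) ^ (l + 1) * ‖J (p (n + 1))‖ ^ 2 := by
        refine Finset.sum_le_sum fun n _ => ?_
        calc ((n : ℝ) + 1) ^ l * ‖J (q n)‖ ^ 2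
            ≤ ((n : ℝ) + 1) ^ l * ((n + 1) * (2 * β ^ 2 * κ) * ‖J (p (n + 1))‖ ^ 2) := by
              gcongr
              exact hJ.norm_dunkl_sq_le_of_level (hp (n + 1))
          _ = 2 * β ^ 2 * κ * ((n : ℝ) + 1) ^ (l + 1) * ‖J (p (n + 1))‖ ^ 2 := by ring
          _ ≤ _ := by
              gcongr
              simp
      refine h1.trans ?_
      rcases M with _ | M
      · simp [hS]
      · rw [hS, Finset.sum_range_succ', Nat.add_sub_cancel, mul_add (2 * β ^ 2 * κ),
          Finset.mul_sum]
        simp only [mul_assoc]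
        exact le_add_of_nonneg_right (by positivity)
    have hrb : ∑ n ∈ Finset.range (M + 1), ((n : ℝ) + 1) ^ l * ‖J (r n)‖ ^ 2 ≤
        2 ^ l * (2 * β ^ 2 * κ) * S := by
      rw [Finset.sum_range_succ', hS, Finset.mul_sum]
      rw [show r 0 = 0 from rfl, map_zero, norm_zero, zero_pow two_ne_zero, mul_zero, add_zero]
      refine Finset.sum_le_sum fun n _ => ?_
      -- Here `n + 2 ≤ 2(n + 1)` brings the weight back to the original index; this is the source of
      -- `2^l` in `dunklConst`.
      calc (((n + 1 : ℕ) : ℝ) + 1) ^ l * ‖J (dunklAdjoint μ β (p n))‖ ^ 2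
          ≤ (2 * ((n : ℝ) + 1)) ^ l * ((n + 1) * (2 * β ^ 2 * κ) * ‖J (p n)‖ ^ 2) := by
            gcongr
            · push_cast
              have : (0 : ℝ) ≤ n := n.cast_nonneg
              linarith
            · exact hJ.norm_dunklAdjoint_sq_le_of_level (hp n)
        _ = _ := by rw [mul_pow]; ring
    have hsplit : (2 : ℂ) • J ((gaussDunkl μ β ^ (l + 1)) (∑ n ∈ Finset.range M, p n)) =
        J ((gaussDunkl μ β ^ l) (∑ n ∈ Finset.range (M - 1), q n)) -
          J ((gaussDunkl μ β ^ l) (∑ n ∈ Finset.range (M + 1), r n)) := by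
      rw [hqs, hrs, pow_succ, Module.End.mul_apply, ← map_sub, ← map_sub, ← two_smul_gaussDunkl,
        map_smul, map_smul]
    have hc : 0 ≤ dunklConst μ l * (β ^ 2) ^ l :=
      mul_nonneg (dunklConst_pos μ l).le (by positivity)
    have h1 := (ih hqL (M - 1)).trans (mul_le_mul_of_nonneg_left hqb hc)
    have h2 := (ih hrL (M + 1)).trans (mul_le_mul_of_nonneg_left hrb hc)
    set a := J ((gaussDunkl μ β ^ l) (∑ n ∈ Finset.range (M - 1), q n))
    set b := J ((gaussDunkl μ β ^ l) (∑ n ∈ Finset.range (M + 1), r n))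
    have h3 : 4 * ‖J ((gaussDunkl μ β ^ (l + 1)) (∑ n ∈ Finset.range M, p n))‖ ^ 2 ≤
        2 * (‖a‖ ^ 2 + ‖b‖ ^ 2) := by
      have h4 := congrArg (fun v => ‖v‖ ^ 2) hsplit
      simp only [norm_smul, Complex.norm_ofNat] at h4
      have h5 : ‖a - b‖ ^ 2 ≤ (‖a‖ + ‖b‖) ^ 2 := by gcongr; exact norm_sub_le _ _
      nlinarith [sq_nonneg (‖a‖ - ‖b‖)]
    have h6 : dunklConst μ (l + 1) = dunklConst μ l * (κ * (1 + 2 ^ l)) :=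
      Finset.prod_range_succ _ _
    rw [h6, pow_succ (β ^ 2) l]
    linarith

/-- The two operators differ by `2μ` times the odd quotient `s` of `p`, so it is enough to control
`g = ∂^k s`. For the odd part `x s` of `p`, the `k`-th derivative of its Dunkl image is `x g' + (k +
1 + 2μ) g`. The Euler identity makes the real part of its pairing with `g` equal to `(k + μ + 1/2)
‖g‖²`, which is coercive. -/
theorem norm_gaussDeriv_pow_succ_le (hJ : IsHermiteEmbedding μ β m J) (hμ : -(1 / 2) < μ) (k : ℕ)
    (p : ℂ[X]) :
    ‖J ((gaussDeriv β ^ (k + 1)) p)‖ ≤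
      (1 + 2 * |μ| / (μ + 1 / 2)) * ‖J ((gaussDeriv β ^ k) (gaussDunkl μ β p))‖ := by
  have hμ' : 0 < μ + 1 / 2 := by linarith
  set s := oddQuotient p with hs
  set g := (gaussDeriv β ^ k) s with hg
  set q := (gaussDeriv β ^ k) (gaussDunkl μ β p) with hq
  have hodd : (gaussDeriv β ^ k) (gaussDunkl μ β (mulX s)) =
      mulX (gaussDeriv β g) + ((k + 1 + 2 * μ : ℝ) : ℂ) • g := by
    rw [gaussDunkl_apply, oddQuotient_mulX_oddQuotient, map_add, map_smul,
      ← Module.End.mul_apply, ← pow_succ, gaussDeriv_iterate_mulX, pow_succ' _ k,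
      Module.End.mul_apply, ← hg]
    push_cast
    module
  have hpar : ‖J ((gaussDeriv β ^ k) (gaussDunkl μ β (reflection p)))‖ = ‖J q‖ := by
    rw [← hJ.norm_reflection q, hq, reflection_gaussDeriv_iterate, reflection_gaussDunkl]
    simp [norm_smul]
  -- Passing to the odd part does not increase the norm: it is half of `p` minus its reflection, and
  -- both contribute `‖J q‖`.
  have hle : ‖J ((gaussDeriv β ^ k) (gaussDunkl μ β (mulX s)))‖ ≤ ‖J q‖ := by
    have h := congrArg (fun v => ‖J ((gaussDeriv β ^ k) (gaussDunkl μ β v))‖)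
      (two_mul_mulX_oddQuotient p)
    simp only [map_smul, map_sub, norm_smul, Complex.norm_ofNat] at h
    have h' := norm_sub_le (J q) (J ((gaussDeriv β ^ k) (gaussDunkl μ β (reflection p))))
    rw [hpar] at h'
    rw [← hs, ← hq] at h
    linarith
  have hgq : (μ + 1 / 2) * ‖J g‖ ≤ ‖J q‖ := by
    have h1 := re_inner_le_norm (𝕜 := ℂ)
      (J ((gaussDeriv β ^ k) (gaussDunkl μ β (mulX s)))) (J g)
    have h2 : RCLike.re (inner ℂ (J ((gaussDeriv β ^ k) (gaussDunkl μ β (mulX s)))) (J g)) =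
        (k + μ + 1 / 2) * ‖J g‖ ^ 2 := by
      rw [hodd, map_add, map_smul, inner_add_left, inner_smul_left, Complex.conj_ofReal]
      have h3 := hJ.re_inner_mulX_gaussDeriv g
      have h4 : (inner ℂ (J g) (J g)).re = ‖J g‖ ^ 2 := inner_self_eq_norm_sq (𝕜 := ℂ) _
      rw [RCLike.re_eq_complex_re, Complex.add_re, h3, Complex.re_ofReal_mul, h4]
      ring
    rw [h2] at h1
    rcases (norm_nonneg (J g)).eq_or_lt with h0 | h0
    · rw [← h0]
      simp
    · refine le_of_mul_le_mul_right ?_ h0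
      have hk : (0 : ℝ) ≤ k * ‖J g‖ ^ 2 := by positivity
      have h5 := mul_le_mul_of_nonneg_right hle h0.le
      nlinarith
  have hdec : J ((gaussDeriv β ^ (k + 1)) p) = J q - (2 * μ : ℂ) • J g := by
    rw [hq, gaussDunkl_apply, map_add, map_smul, pow_succ, Module.End.mul_apply, map_add, map_smul]
    simp [hg, hs]
  have hn : ‖(2 * μ : ℂ) • J g‖ = 2 * |μ| * ‖J g‖ := by
    rw [norm_smul]
    simp
  calc ‖J ((gaussDeriv β ^ (k + 1)) p)‖ ≤ ‖J q‖ + 2 * |μ| * ‖J g‖ := by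
        rw [hdec, ← hn]; exact norm_sub_le _ _
    _ ≤ ‖J q‖ + 2 * |μ| * (‖J q‖ / (μ + 1 / 2)) := by
        gcongr
        rw [le_div_iff₀ hμ', mul_comm]
        exact hgq
    _ = _ := by ring

/-- Ordinary derivatives are exchanged for Dunkl operators one at a time, the innermost first. -/
theorem norm_gaussDeriv_pow_le (hJ : IsHermiteEmbedding μ β m J) (hμ : -(1 / 2) < μ) (l : ℕ)
    (p : ℂ[X]) :
    ‖J ((gaussDeriv β ^ l) p)‖ ≤
      (1 + 2 * |μ| / (μ + 1 / 2)) ^ l * ‖J ((gaussDunkl μ β ^ l) p)‖ := by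
  have hμ' : 0 < μ + 1 / 2 := by linarith
  induction l generalizing p with
  | zero => simp
  | succ l ih =>
    calc _ ≤ (1 + 2 * |μ| / (μ + 1 / 2)) * ‖J ((gaussDeriv β ^ l) (gaussDunkl μ β p))‖ :=
          hJ.norm_gaussDeriv_pow_succ_le hμ l p
      _ ≤ (1 + 2 * |μ| / (μ + 1 / 2)) * ((1 + 2 * |μ| / (μ + 1 / 2)) ^ l *
            ‖J ((gaussDunkl μ β ^ l) (gaussDunkl μ β p))‖) := by
          gcongr
          exact ih _
      _ = _ := by
          rw [pow_succ (gaussDunkl μ β), Module.End.mul_apply]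
          ring

end IsHermiteEmbedding

/-- The constant in the inverse inequality for iterated derivatives. -/
def derivConst (μ : ℝ) (l : ℕ) : ℝ :=
  ((1 + 2 * |μ| / (μ + 1 / 2)) ^ l) ^ 2 * dunklConst μ l

theorem derivConst_pos {μ : ℝ} (hμ : -(1 / 2) < μ) (l : ℕ) : 0 < derivConst μ l := by
  have hμ' : 0 < μ + 1 / 2 := by linarith
  exact mul_pos (by positivity) (dunklConst_pos μ l)

theorem IsHermiteEmbedding.norm_gaussDeriv_pow_sum_sq_le {μ β : ℝ} {m : ℕ → ℝ}
    {J : ℂ[X] →ₗ[ℂ] E} (hJ : IsHermiteEmbedding μ β m J) (hμ : -(1 / 2) < μ) (l : ℕ)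
    {p : ℕ → ℂ[X]} (hp : ∀ n, IsHermiteLevel J n (p n)) (M : ℕ) :
    ‖J ((gaussDeriv β ^ l) (∑ n ∈ Finset.range M, p n))‖ ^ 2 ≤
      derivConst μ l * (β ^ 2) ^ l *
        ∑ n ∈ Finset.range M, ((n : ℝ) + 1) ^ l * ‖J (p n)‖ ^ 2 := by
  have hμ' : 0 < μ + 1 / 2 := by linarith
  calc _ ≤ ((1 + 2 * |μ| / (μ + 1 / 2)) ^ l *
        ‖J ((gaussDunkl μ β ^ l) (∑ n ∈ Finset.range M, p n))‖) ^ 2 := by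
        gcongr
        exact hJ.norm_gaussDeriv_pow_le hμ l _
    _ = ((1 + 2 * |μ| / (μ + 1 / 2)) ^ l) ^ 2 *
        ‖J ((gaussDunkl μ β ^ l) (∑ n ∈ Finset.range M, p n))‖ ^ 2 := mul_pow _ _ _
    _ ≤ ((1 + 2 * |μ| / (μ + 1 / 2)) ^ l) ^ 2 * (dunklConst μ l * (β ^ 2) ^ l *
        ∑ n ∈ Finset.range M, ((n : ℝ) + 1) ^ l * ‖J (p n)‖ ^ 2) :=
        mul_le_mul_of_nonneg_left (hJ.norm_gaussDunkl_pow_sum_sq_le l hp M) (by positivity)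
    _ = _ := by rw [derivConst]; ring

end HermiteEmbedding

theorem isHermiteEmbedding_hermiteMap {μ β : ℝ} (hμ : -(1 / 2) < μ) (hβ : 0 < β) :
    IsHermiteEmbedding μ β (hermiteMoment μ β) (hermiteMap hμ hβ) where
  inner_X_pow := inner_hermiteMap_X_pow hμ hβ
  moment_of_odd _ hk := hermiteMoment_of_odd hk
  moment_add_two := hermiteMoment_add_two hμ hβ

/-! ### Pairings with test functions and weak derivatives. -/

theorem rpow_neg_mul_rpow_abs {μ x : ℝ} (hx : x ≠ 0) : |x| ^ (-(2 * μ)) * |x| ^ (2 * μ) = 1 := by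
  rw [← Real.rpow_add (abs_pos.2 hx)]
  simp

/-- Integration against `φ` is a continuous functional on `L²(|x|^{2μ} dx)` as soon as
`φ` belongs to `L²(|x|^{-2μ} dx)`. -/
theorem exists_integral_pairing (μ : ℝ) {φ : ℝ → ℂ} (hm : AEStronglyMeasurable φ volume)
    (hφ : Integrable fun x => |x| ^ (-(2 * μ)) * ‖φ x‖ ^ 2) :
    ∃ L : Lp ℂ 2 (weight μ) →L[ℂ] ℂ, ∀ v : Lp ℂ 2 (weight μ),
      Integrable (fun x => v x * φ x) ∧ L v = ∫ x, v x * φ x := by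
  -- The Riesz representative: dividing by the weight turns the unweighted pairing into the weighted
  -- inner product.
  set ψ : ℝ → ℂ := fun x => (|x| ^ (-(2 * μ)) : ℝ) • (starRingEnd ℂ) (φ x) with hψ
  have hψm : AEStronglyMeasurable ψ volume :=
    (measurable_abs_rpow _).aestronglyMeasurable.smul
      (Complex.continuous_conj.comp_aestronglyMeasurable hm)
  have hψL : MemLp ψ 2 (weight μ) := by
    rw [memLp_two_iff_integrable_sq_norm (hψm.mono_ac (weight_absolutelyContinuous μ))]
    suffices h : Integrable (fun x => ((‖ψ x‖ ^ 2 : ℝ) : ℂ)) (weight μ) from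
      h.re.congr (ae_of_all _ fun x => Complex.ofReal_re _)
    rw [integrable_weight_iff]
    refine hφ.ofReal.congr ?_
    filter_upwards [Measure.ae_ne volume (0 : ℝ)] with x hx
    have h0 : (0 : ℝ) ≤ |x| ^ (-(2 * μ)) := by positivity
    have h1 : ‖ψ x‖ = |x| ^ (-(2 * μ)) * ‖φ x‖ := by
      rw [hψ]
      simp only
      rw [norm_smul, Real.norm_of_nonneg h0, RCLike.norm_conj]
    rw [h1, Complex.real_smul, ← Complex.ofReal_mul]
    refine congrArg Complex.ofReal ?_
    change |x| ^ (-(2 * μ)) * ‖φ x‖ ^ 2 = _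
    linear_combination -(|x| ^ (-(2 * μ)) * ‖φ x‖ ^ 2) * rpow_neg_mul_rpow_abs (μ := μ) hx
  have key : ∀ v : Lp ℂ 2 (weight μ),
      (fun x => (|x| ^ (2 * μ) : ℝ) • inner ℂ (ψ x) (v x)) =ᵐ[volume] fun x => v x * φ x := by
    intro v
    filter_upwards [Measure.ae_ne volume (0 : ℝ)] with x hx
    have h1 : ((|x| ^ (-(2 * μ)) : ℝ) : ℂ) * ((|x| ^ (2 * μ) : ℝ) : ℂ) = 1 := by
      rw [← Complex.ofReal_mul, rpow_neg_mul_rpow_abs hx, Complex.ofReal_one]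
    rw [RCLike.inner_apply, hψ]
    simp only [Complex.real_smul, map_mul, Complex.conj_ofReal, Complex.conj_conj]
    linear_combination (v x * φ x) * h1
  have key' : ∀ v : Lp ℂ 2 (weight μ),
      (fun x => inner ℂ ((hψL.toLp ψ) x) (v x)) =ᵐ[weight μ] fun x => inner ℂ (ψ x) (v x) := by
    intro v
    filter_upwards [hψL.coeFn_toLp] with x hx
    rw [hx]
  refine ⟨innerSL ℂ (hψL.toLp ψ), fun v => ⟨?_, ?_⟩⟩
  · have h := (L2.integrable_inner (𝕜 := ℂ) (hψL.toLp ψ) v).congr (key' v)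
    rw [integrable_weight_iff] at h
    exact h.congr (key v)
  · rw [innerSL_apply_apply, L2.inner_def, integral_congr_ae (key' v), integral_weight,
      integral_congr_ae (key v)]

/-- Pair `v` with the indicator of a compact `K`; the condition on that indicator is precisely
integrability of `|x|^{-2μ}` on `K`. -/
theorem locallyIntegrableOn_of_Lp_weight {μ : ℝ} {Ω : Set ℝ} (hΩ : IsOpen Ω)
    (hw : LocallyIntegrableOn (fun x : ℝ => |x| ^ (-(2 * μ))) Ω) (v : Lp ℂ 2 (weight μ)) :
    LocallyIntegrableOn v Ω := by
  rw [locallyIntegrableOn_iff hΩ.isLocallyClosed] at hw ⊢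
  intro K hKΩ hK
  obtain ⟨L, hL⟩ := exists_integral_pairing μ (φ := K.indicator fun _ => 1)
    ((aestronglyMeasurable_const).indicator hK.measurableSet) (by
      refine ((hw K hKΩ hK).integrable_indicator hK.measurableSet).congr (ae_of_all _ fun x => ?_)
      by_cases hx : x ∈ K <;> simp [hx])
  rw [← integrable_indicator_iff hK.measurableSet]
  refine (hL v).1.congr (ae_of_all _ fun x => ?_)
  by_cases hx : x ∈ K <;> simp [hx]

theorem integrable_rpow_mul_norm_sq_of_hasCompactSupport {μ : ℝ} {Ω : Set ℝ} (hΩ : IsOpen Ω)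
    (hw : LocallyIntegrableOn (fun x : ℝ => |x| ^ (-(2 * μ))) Ω) {φ : ℝ → ℂ} (hφ : Continuous φ)
    (hc : HasCompactSupport φ) (hs : tsupport φ ⊆ Ω) :
    Integrable fun x => |x| ^ (-(2 * μ)) * ‖φ x‖ ^ 2 := by
  rw [locallyIntegrableOn_iff hΩ.isLocallyClosed] at hw
  have hK : IsCompact (tsupport φ) := hc
  have h := (hw _ hs hK).mul_continuousOn (g' := fun x => ‖φ x‖ ^ 2)
    (hφ.norm.pow 2).continuousOn hK
  rw [integrableOn_iff_integrable_of_support_subset] at h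
  · exact h
  · intro x hx
    by_contra hx'
    exact hx (by simp [image_eq_zero_of_notMem_tsupport hx'])

theorem locallyIntegrableOn_rpow_compl_zero (s : ℝ) :
    LocallyIntegrableOn (fun x : ℝ => |x| ^ s) {0}ᶜ := by
  refine ContinuousOn.locallyIntegrableOn (fun x hx => ?_) (measurableSet_singleton 0).compl
  exact (continuous_abs.continuousAt.rpow_const (Or.inl (abs_ne_zero.2 hx))).continuousWithinAt

/-- The bound says `-μ > -1/2`, so the Gaussian moment with parameter `-μ` is finite; multiplying by
the continuous `e^{x²}` removes the Gaussian. -/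
theorem locallyIntegrableOn_rpow_univ {μ : ℝ} (hμ : μ < 1 / 2) :
    LocallyIntegrableOn (fun x : ℝ => |x| ^ (-(2 * μ))) univ := by
  have h := integrable_moment (μ := -μ) (β := 1) (by linarith) one_pos 0
  have h' := h.locallyIntegrable.locallyIntegrableOn univ
  have h2 := h'.mul_continuousOn (g := fun x => Real.exp (x ^ 2))
    (by fun_prop) isOpen_univ.isLocallyClosed
  refine h2.congr (ae_of_all _ fun x => ?_)
  simp only
  rw [mul_assoc, mul_assoc, ← Real.exp_add]
  simp

theorem hasDerivAt_hermiteFun (β : ℝ) (p : Polynomial ℂ) (x : ℝ) :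
    HasDerivAt (hermiteFun β p) (hermiteFun β (gaussDeriv β p) x) x := by
  have h1 : HasDerivAt (fun y : ℝ => ((Real.exp (-(β ^ 2 * y ^ 2) / 2) : ℝ) : ℂ))
      ((Real.exp (-(β ^ 2 * x ^ 2) / 2) * (-(β ^ 2 * x)) : ℝ) : ℂ) x := by
    refine HasDerivAt.ofReal_comp ?_
    refine HasDerivAt.exp ?_
    have := (((hasDerivAt_pow 2 x).const_mul (β ^ 2)).neg).div_const 2
    exact this.congr_deriv (by push_cast; ring)
  have h2 : HasDerivAt (fun y : ℝ => p.eval (y : ℂ)) (p.derivative.eval (x : ℂ)) x :=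
    (p.hasDerivAt (x : ℂ)).comp_ofReal
  have h3 := h1.mul h2
  refine h3.congr_deriv ?_
  simp only [hermiteFun, gaussDeriv_apply, mulX_apply, Polynomial.eval_sub, Polynomial.eval_smul,
    Polynomial.eval_mul, Polynomial.eval_X, smul_eq_mul]
  push_cast
  ring

theorem integral_hermiteFun_mul_iteratedDeriv (β : ℝ) (l : ℕ) (p : Polynomial ℂ) {φ : ℝ → ℂ}
    (hφ : ContDiff ℝ (⊤ : ℕ∞) φ) (hc : HasCompactSupport φ) :
    ∫ x, hermiteFun β p x * iteratedDeriv l φ x =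
      (-1) ^ l * ∫ x, hermiteFun β ((gaussDeriv β ^ l) p) x * φ x := by
  induction l generalizing p with
  | zero => simp
  | succ l ih =>
    have hd : ∀ k, Differentiable ℝ (iteratedDeriv k φ) := fun k =>
      hφ.differentiable_iteratedDeriv k (by exact_mod_cast WithTop.coe_lt_top _)
    have hcs : ∀ k, HasCompactSupport (iteratedDeriv k φ) := by
      intro k
      induction k with
      | zero => simpa using hc
      | succ k ihk => rw [iteratedDeriv_succ]; exact ihk.deriv
    have hintegrable : ∀ (q : Polynomial ℂ) k,
        Integrable (hermiteFun β q * iteratedDeriv k φ) := fun q k =>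
      ((continuous_hermiteFun β q).mul (hd k).continuous).integrable_of_hasCompactSupport
        (hcs k).mul_left
    have h := integral_mul_deriv_eq_deriv_mul_of_integrable
      (u := hermiteFun β p) (v := iteratedDeriv l φ) (u' := hermiteFun β (gaussDeriv β p))
      (v' := iteratedDeriv (l + 1) φ) (fun x _ => hasDerivAt_hermiteFun β p x)
      (fun x _ => by rw [iteratedDeriv_succ]; exact (hd l x).hasDerivAt)
      (hintegrable _ _) (hintegrable _ _) (hintegrable _ _)
    rw [h, ih, pow_succ (gaussDeriv β), Module.End.mul_apply]
    ring

/-- Weak derivatives of limits of functions `e^{-β²x²/2} p(x)`. -/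
theorem hasWeakDeriv_of_tendsto_hermiteMap {μ β : ℝ} (hμ : -(1 / 2) < μ) (hβ : 0 < β) {Ω : Set ℝ}
    (hΩ : IsOpen Ω) (hw : LocallyIntegrableOn (fun x : ℝ => |x| ^ (-(2 * μ))) Ω) (l : ℕ)
    {q : ℕ → Polynomial ℂ} {v G : Lp ℂ 2 (weight μ)}
    (hv : Filter.Tendsto (fun n => hermiteMap hμ hβ (q n)) Filter.atTop (nhds v))
    (hG : Filter.Tendsto (fun n => hermiteMap hμ hβ ((gaussDeriv β ^ l) (q n)))
      Filter.atTop (nhds G)) :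
    HasWeakDeriv Ω l v G := by
  refine ⟨locallyIntegrableOn_of_Lp_weight hΩ hw v, locallyIntegrableOn_of_Lp_weight hΩ hw G,
    fun φ hφ hc hs => ?_⟩
  have hd : Continuous (iteratedDeriv l φ) :=
    hφ.continuous_iteratedDeriv l (by exact_mod_cast le_top)
  have hsub : ∀ k, tsupport (iteratedDeriv k φ) ⊆ tsupport φ := by
    intro k
    induction k with
    | zero => simp
    | succ k ihk => rw [iteratedDeriv_succ]; exact (tsupport_deriv_subset (𝕜 := ℝ)).trans ihk
  have hcd : HasCompactSupport (iteratedDeriv l φ) :=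
    IsCompact.of_isClosed_subset hc (isClosed_tsupport _) (hsub l)
  obtain ⟨L₁, hL₁⟩ := exists_integral_pairing μ hd.aestronglyMeasurable
    (integrable_rpow_mul_norm_sq_of_hasCompactSupport hΩ hw hd hcd ((hsub l).trans hs))
  obtain ⟨L₂, hL₂⟩ := exists_integral_pairing μ hφ.continuous.aestronglyMeasurable
    (integrable_rpow_mul_norm_sq_of_hasCompactSupport hΩ hw hφ.continuous hc hs)
  have hJ : ∀ (p : Polynomial ℂ) (χ : ℝ → ℂ),
      ∫ x, hermiteMap hμ hβ p x * χ x = ∫ x, hermiteFun β p x * χ x := fun p χ =>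
    integral_congr_ae (by
      filter_upwards [(volume_absolutelyContinuous_weight μ).ae_eq (coeFn_hermiteMap hμ hβ p)]
        with x hx
      rw [hx])
  -- Both sides of the weak-derivative identity are continuous functionals, and for each `q n` the
  -- identity is classical.
  have h1 := (L₁.continuous.tendsto v).comp hv
  have h2 := ((L₂.continuous.tendsto G).comp hG).const_mul ((-1 : ℂ) ^ l)
  rw [← (hL₁ v).2, ← (hL₂ G).2]
  refine tendsto_nhds_unique h1 (h2.congr fun n => ?_)
  simp only [Function.comp_apply]
  rw [(hL₁ _).2, (hL₂ _).2, hJ, hJ, integral_hermiteFun_mul_iteratedDeriv β l _ hφ hc]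

/-- The fundamental lemma of the calculus of variations off the origin, which is a null set. It
transfers the norm bound from the constructed derivative to an arbitrary one. -/
theorem HasWeakDeriv.ae_eq_weight {μ : ℝ} {l : ℕ} {v g G : ℝ → ℂ}
    (hg : HasWeakDeriv {0}ᶜ l v g) (hG : HasWeakDeriv {0}ᶜ l v G) : g =ᵐ[weight μ] G := by
  have hopen : IsOpen ({0}ᶜ : Set ℝ) := isOpen_compl_singleton
  have hintegrable : ∀ {h : ℝ → ℂ}, LocallyIntegrableOn h {0}ᶜ → ∀ {φ : ℝ → ℝ}, Continuous φ →
      HasCompactSupport φ → tsupport φ ⊆ {0}ᶜ → Integrable fun x => φ x • h x := by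
    intro h hh φ hφ hc hs
    rw [locallyIntegrableOn_iff hopen.isLocallyClosed] at hh
    have h1 := (hh _ hs hc).continuousOn_smul (f := φ) hφ.continuousOn hc
    rw [integrableOn_iff_integrable_of_support_subset] at h1
    · exact h1
    · intro x hx
      by_contra hx'
      exact hx (by simp [image_eq_zero_of_notMem_tsupport hx'])
  have h := hopen.ae_eq_zero_of_integral_contDiff_smul_eq_zero (μ := volume) (f := g - G)
    (hg.2.1.sub hG.2.1) (fun φ hφ hc hs => by
      have hs' : tsupport (fun x => (φ x : ℂ)) ⊆ tsupport φ :=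
        closure_mono fun x hx => by simpa using hx
      have hc' : HasCompactSupport fun x => (φ x : ℂ) :=
        hc.comp_left (g := fun y : ℝ => (y : ℂ)) Complex.ofReal_zero
      have hφ' : ContDiff ℝ (⊤ : ℕ∞) fun x => (φ x : ℂ) :=
        Complex.ofRealCLM.contDiff.comp hφ
      have e1 := hg.2.2 _ hφ' hc' (hs'.trans hs)
      have e2 := hG.2.2 _ hφ' hc' (hs'.trans hs)
      have e3 := mul_left_cancel₀ (pow_ne_zero l (by norm_num : (-1 : ℂ) ≠ 0)) (e1.symm.trans e2)
      simp only [Pi.sub_apply, smul_sub]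
      rw [integral_sub (hintegrable hg.2.1 hφ.continuous hc hs)
        (hintegrable hG.2.1 hφ.continuous hc hs),
        sub_eq_zero]
      simpa only [Complex.real_smul, mul_comm] using e3)
  refine (weight_absolutelyContinuous μ).ae_eq ?_
  filter_upwards [h, Measure.ae_ne volume (0 : ℝ)] with x hx hx0
  exact sub_eq_zero.1 (hx hx0)

/-! ### Increments of the projections. -/

theorem hermiteSpace_mono {μ β : ℝ} (hμ : -(1 / 2) < μ) (hβ : 0 < β) {m n : ℕ} (h : m ≤ n) :
    hermiteSpace μ β m ≤ hermiteSpace μ β n := by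
  intro φ hφ
  obtain ⟨p, hp, rfl⟩ := (mem_hermiteSpace_iff hμ hβ).1 hφ
  exact (mem_hermiteSpace_iff hμ hβ).2
    ⟨p, Polynomial.degreeLT_mono (Nat.succ_le_succ h) hp, rfl⟩

theorem inner_sub_hermiteProj (μ β : ℝ) {n : ℕ} (u : Lp ℂ 2 (weight μ)) {w : Lp ℂ 2 (weight μ)}
    (hw : w ∈ hermiteSpace μ β n) : inner ℂ w (u - hermiteProj μ β n u) = 0 := by
  rw [← inner_conj_symm, hermiteProj, Submodule.starProjection_inner_eq_zero _ _ hw, map_zero]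

theorem norm_hermiteProj_succ_sub_sq {μ β : ℝ} (hμ : -(1 / 2) < μ) (hβ : 0 < β) (n : ℕ)
    (u : Lp ℂ 2 (weight μ)) :
    ‖hermiteProj μ β (n + 1) u - hermiteProj μ β n u‖ ^ 2 =
      ‖u - hermiteProj μ β n u‖ ^ 2 - ‖u - hermiteProj μ β (n + 1) u‖ ^ 2 := by
  have hmem : hermiteProj μ β (n + 1) u - hermiteProj μ β n u ∈ hermiteSpace μ β (n + 1) :=
    Submodule.sub_mem _ (Submodule.starProjection_apply_mem _ _)
      (hermiteSpace_mono hμ hβ n.le_succ (Submodule.starProjection_apply_mem _ _))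
  have h := norm_add_sq_eq_norm_sq_add_norm_sq_of_inner_eq_zero _ _
    (inner_sub_hermiteProj μ β u hmem)
  rw [show hermiteProj μ β (n + 1) u - hermiteProj μ β n u + (u - hermiteProj μ β (n + 1) u) =
    u - hermiteProj μ β n u by abel] at h
  linarith

/-- The increments of the Hermite projections beyond `N` come from polynomials on the
successive levels. -/
theorem exists_isHermiteLevel_increments {μ β : ℝ} (hμ : -(1 / 2) < μ) (hβ : 0 < β) (N : ℕ)
    (u : Lp ℂ 2 (weight μ)) :
    ∃ p : ℕ → Polynomial ℂ, (∀ n, IsHermiteLevel (hermiteMap hμ hβ) n (p n)) ∧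
      (∀ n ≤ N, p n = 0) ∧
      ∀ n, N ≤ n → hermiteMap hμ hβ (p (n + 1)) =
        hermiteProj μ β (n + 1) u - hermiteProj μ β n u := by
  have key : ∀ n : ℕ, ∃ p : Polynomial ℂ, IsHermiteLevel (hermiteMap hμ hβ) n p ∧
      (n ≤ N → p = 0) ∧ ∀ k, n = k + 1 → N ≤ k → hermiteMap hμ hβ p =
        hermiteProj μ β (k + 1) u - hermiteProj μ β k u := by
    intro n
    by_cases hn : n ≤ N
    · exact ⟨0, isHermiteLevel_zero _ n, fun _ => rfl, fun k hk hk' => by omega⟩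
    · obtain ⟨k, rfl⟩ : ∃ k, n = k + 1 := ⟨n - 1, by omega⟩
      have hmem : hermiteProj μ β (k + 1) u - hermiteProj μ β k u ∈ hermiteSpace μ β (k + 1) :=
        Submodule.sub_mem _ (Submodule.starProjection_apply_mem _ _)
          (hermiteSpace_mono hμ hβ k.le_succ (Submodule.starProjection_apply_mem _ _))
      obtain ⟨p, hp, hpe⟩ := (mem_hermiteSpace_iff hμ hβ).1 hmem
      refine ⟨p, ⟨hp, fun q hq => ?_⟩, fun h => absurd h hn, ?_⟩
      -- The increment is a difference of two errors, both orthogonal to the smaller space.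
      · have hq1 : hermiteMap hμ hβ q ∈ hermiteSpace μ β k :=
          (mem_hermiteSpace_iff hμ hβ).2 ⟨q, hq, rfl⟩
        have h1 := inner_sub_hermiteProj μ β u hq1
        have h2 := inner_sub_hermiteProj μ β u (hermiteSpace_mono hμ hβ k.le_succ hq1)
        rw [hpe, show hermiteProj μ β (k + 1) u - hermiteProj μ β k u =
          (u - hermiteProj μ β k u) - (u - hermiteProj μ β (k + 1) u) by abel, inner_sub_right,
          h1, h2, sub_zero]
      · rintro k' hk' -
        obtain rfl : k = k' := by omega
        exact hpe
  choose p h1 h2 h3 using key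
  exact ⟨p, h1, fun n hn => h2 n hn, fun n hn => h3 (n + 1) n rfl hn⟩

/-! ### Tail integrals and summation by parts. -/

theorem tendsto_setLIntegral_Ioi_atTop {F : ℝ → ℝ≥0∞} {N : ℕ}
    (hF : AEMeasurable F (volume.restrict (Ioi (N : ℝ))))
    (hfin : ∫⁻ x in Ioi (N : ℝ), F x ≠ ∞) :
    Filter.Tendsto (fun n : ℕ => ∫⁻ x in Ioi (n : ℝ), F x) Filter.atTop (nhds 0) := by
  have h := tendsto_lintegral_of_dominated_convergence' (μ := volume.restrict (Ioi (N : ℝ)))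
    (F := fun n : ℕ => (Ioi (n : ℝ)).indicator F) (f := fun _ => 0) F
    (fun n => hF.indicator measurableSet_Ioi)
    (fun n => ae_of_all _ fun x => indicator_le_self _ _ _) hfin
    (ae_of_all _ fun x => by
      obtain ⟨k, hk⟩ := exists_nat_ge x
      refine tendsto_const_nhds.congr' ?_
      filter_upwards [Filter.eventually_ge_atTop k] with n hn
      rw [indicator_of_notMem]
      rw [mem_Ioi, not_lt]
      exact hk.trans (by exact_mod_cast hn))
  rw [lintegral_zero] at h
  refine h.congr' ?_
  filter_upwards [Filter.eventually_ge_atTop N] with n hn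
  rw [lintegral_indicator measurableSet_Ioi, Measure.restrict_restrict measurableSet_Ioi,
    inter_eq_left.2 (Ioi_subset_Ioi (by exact_mod_cast hn))]

/-- Summation by parts for a sequence dominated by the tails of an integral. -/
theorem ofReal_abel_sum_le {l N : ℕ} {F : ℝ → ℝ≥0∞} {c : ℝ≥0∞} {r S : ℕ → ℝ}
    (hF : AEMeasurable F (volume.restrict (Ioi (N : ℝ))))
    (hr : ∀ n, N ≤ n → ENNReal.ofReal (r n) ≤ c * ∫⁻ x in Ioi (n : ℝ), F x)
    (hSN : S N = 0)
    (hS : ∀ n, N ≤ n → S (n + 1) = S n + ((n : ℝ) + 2) ^ l * (r n - r (n + 1))) {M : ℕ}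
    (hM : N ≤ M) :
    ENNReal.ofReal (S M + ((M : ℝ) + 1) ^ l * r M) ≤
      c * ∫⁻ x in Ioi (N : ℝ), F x * ENNReal.ofReal (min (x + 2) ((M : ℝ) + 1) ^ l) := by
  induction M, hM using Nat.le_induction with
  | base =>
    rw [hSN, zero_add, ENNReal.ofReal_mul (by positivity), mul_comm]
    calc ENNReal.ofReal (r N) * ENNReal.ofReal (((N : ℝ) + 1) ^ l)
        ≤ c * (∫⁻ x in Ioi (N : ℝ), F x) * ENNReal.ofReal (((N : ℝ) + 1) ^ l) := by
          gcongr
          exact hr N le_rfl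
      _ = c * ∫⁻ x in Ioi (N : ℝ), F x * ENNReal.ofReal (((N : ℝ) + 1) ^ l) := by
          rw [lintegral_mul_const' _ _ ENNReal.ofReal_ne_top, mul_assoc]
      _ = _ := by
          congr 1
          refine setLIntegral_congr_fun measurableSet_Ioi fun x hx => ?_
          rw [min_eq_right (by have : (N : ℝ) < x := hx; linarith)]
  | succ M hM ih =>
    set δ : ℝ := ((M : ℝ) + 2) ^ l - ((M : ℝ) + 1) ^ l with hδ
    have hδ0 : 0 ≤ δ := sub_nonneg.2 (by gcongr; norm_num)
    have hN0 : (0 : ℝ) ≤ N := N.cast_nonneg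
    have hM0 : (0 : ℝ) ≤ M := M.cast_nonneg
    -- Carrying the boundary term `(M+1)^l r M` in the claim makes `r (M+1)` cancel, so only `r M`
    -- with the nonnegative coefficient `δ` remains to be bounded.
    have e : S (M + 1) + (((M + 1 : ℕ) : ℝ) + 1) ^ l * r (M + 1) =
        (S M + ((M : ℝ) + 1) ^ l * r M) + δ * r M := by
      rw [hS M hM, hδ]
      push_cast
      ring
    have hind : ∫⁻ x in Ioi (M : ℝ), F x =
        ∫⁻ x in Ioi (N : ℝ), (Ioi (M : ℝ)).indicator F x := by
      rw [lintegral_indicator measurableSet_Ioi, Measure.restrict_restrict measurableSet_Ioi,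
        inter_eq_left.2 (Ioi_subset_Ioi (by exact_mod_cast hM))]
    calc ENNReal.ofReal (S (M + 1) + (((M + 1 : ℕ) : ℝ) + 1) ^ l * r (M + 1))
        ≤ ENNReal.ofReal (S M + ((M : ℝ) + 1) ^ l * r M) + ENNReal.ofReal (δ * r M) := by
          rw [e]
          exact ENNReal.ofReal_add_le
      _ ≤ c * (∫⁻ x in Ioi (N : ℝ), F x * ENNReal.ofReal (min (x + 2) ((M : ℝ) + 1) ^ l)) +
          c * (∫⁻ x in Ioi (N : ℝ), (Ioi (M : ℝ)).indicator F x * ENNReal.ofReal δ) := by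
          refine add_le_add ih ?_
          rw [lintegral_mul_const' _ _ ENNReal.ofReal_ne_top, ← hind, ← mul_assoc, mul_comm δ,
            ENNReal.ofReal_mul' hδ0]
          gcongr
          exact hr M hM
      _ = c * ∫⁻ x in Ioi (N : ℝ), (F x * ENNReal.ofReal (min (x + 2) ((M : ℝ) + 1) ^ l) +
          (Ioi (M : ℝ)).indicator F x * ENNReal.ofReal δ) := by
          rw [← mul_add, lintegral_add_left'
            (f := fun x => F x * ENNReal.ofReal (min (x + 2) ((M : ℝ) + 1) ^ l))
            (hF.mul (by fun_prop))]
      _ ≤ _ := by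
          refine mul_le_mul_right ?_ c
          refine setLIntegral_mono' measurableSet_Ioi fun x hx => ?_
          have hx : (N : ℝ) < x := hx
          have h0 : 0 ≤ min (x + 2) ((M : ℝ) + 1) := le_min (by linarith) (by linarith)
          -- For `x > M` the truncated weight `min (x + 2) (M + 1)` rises to `M + 2`, so its power
          -- gains exactly `δ`; elsewhere monotonicity suffices.
          by_cases hxM : (M : ℝ) < x
          · rw [indicator_of_mem (show x ∈ Ioi (M : ℝ) from hxM), ← mul_add,
              ← ENNReal.ofReal_add (pow_nonneg h0 l) hδ0, min_eq_right (by linarith),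
              min_eq_right (by push_cast; linarith), hδ]
            refine le_of_eq ?_
            congr 2
            push_cast
            ring
          · rw [indicator_of_notMem (show x ∉ Ioi (M : ℝ) from hxM), zero_mul, add_zero]
            gcongr
            linarith

/-- On `x > N ≥ 1` one has `x + 2 ≤ 3x`, which yields `3^l` and a bound uniform in `M`. -/
theorem ofReal_abel_sum_le_pow {l N : ℕ} (hN : 1 ≤ N) {F : ℝ → ℝ≥0∞} {c : ℝ≥0∞} {r S : ℕ → ℝ}
    (hF : AEMeasurable F (volume.restrict (Ioi (N : ℝ)))) (hr0 : ∀ n, 0 ≤ r n)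
    (hr : ∀ n, N ≤ n → ENNReal.ofReal (r n) ≤ c * ∫⁻ x in Ioi (n : ℝ), F x)
    (hSN : S N = 0)
    (hS : ∀ n, N ≤ n → S (n + 1) = S n + ((n : ℝ) + 2) ^ l * (r n - r (n + 1))) {M : ℕ}
    (hM : N ≤ M) :
    ENNReal.ofReal (S M) ≤
      c * (3 ^ l * ∫⁻ x in Ioi (N : ℝ), F x * ENNReal.ofReal (x ^ l)) := by
  calc ENNReal.ofReal (S M) ≤ ENNReal.ofReal (S M + ((M : ℝ) + 1) ^ l * r M) := by
        refine ENNReal.ofReal_le_ofReal (le_add_of_nonneg_right ?_)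
        have := hr0 M
        positivity
    _ ≤ _ := ofReal_abel_sum_le hF hr hSN hS hM
    _ ≤ _ := by
        refine mul_le_mul_right ?_ c
        rw [← lintegral_const_mul' _ _ (by simp)]
        refine setLIntegral_mono' measurableSet_Ioi fun x hx => ?_
        have hx : (N : ℝ) < x := hx
        have hN' : (1 : ℝ) ≤ N := by exact_mod_cast hN
        have hM0 : (0 : ℝ) ≤ M := M.cast_nonneg
        have h0 : 0 ≤ min (x + 2) ((M : ℝ) + 1) := le_min (by linarith) (by linarith)
        have h1 : min (x + 2) ((M : ℝ) + 1) ^ l ≤ 3 ^ l * x ^ l := by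
          rw [← mul_pow]
          exact pow_le_pow_left₀ h0 ((min_le_left _ _).trans (by linarith)) l
        calc F x * ENNReal.ofReal (min (x + 2) ((M : ℝ) + 1) ^ l)
            ≤ F x * ENNReal.ofReal (3 ^ l * x ^ l) := by gcongr
          _ = _ := by
            rw [ENNReal.ofReal_mul (by positivity), ENNReal.ofReal_pow (by norm_num),
              ENNReal.ofReal_ofNat]
            ring

/-! ### Convergence of the differentiated expansion. -/

/-- If the weighted squared norms of the levels are summable, then the derivatives of the partial
sums converge, with the corresponding bound. -/
theorem exists_tendsto_gaussDeriv_partialSum {μ β : ℝ} (hμ : -(1 / 2) < μ) (hβ : 0 < β) (l : ℕ)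
    {p : ℕ → Polynomial ℂ} (hp : ∀ n, IsHermiteLevel (hermiteMap hμ hβ) n (p n)) {B : ℝ}
    (hB : ∀ M, ∑ n ∈ Finset.range M, ((n : ℝ) + 1) ^ l * ‖hermiteMap hμ hβ (p n)‖ ^ 2 ≤ B) :
    ∃ G : Lp ℂ 2 (weight μ),
      Filter.Tendsto (fun M => hermiteMap hμ hβ ((gaussDeriv β ^ l) (∑ n ∈ Finset.range M, p n)))
        Filter.atTop (nhds G) ∧ ‖G‖ ^ 2 ≤ derivConst μ l * (β ^ 2) ^ l * B := by
  set J := hermiteMap hμ hβ with hJdef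
  have hJ : IsHermiteEmbedding μ β (hermiteMoment μ β) J := isHermiteEmbedding_hermiteMap hμ hβ
  set K := derivConst μ l * (β ^ 2) ^ l with hK
  have hK0 : 0 ≤ K := mul_nonneg (derivConst_pos hμ l).le (by positivity)
  set a : ℕ → ℝ := fun n => ((n : ℝ) + 1) ^ l * ‖J (p n)‖ ^ 2 with ha
  have ha0 : ∀ n, 0 ≤ a n := fun n => by positivity
  have hsum : Summable a := summable_of_sum_range_le ha0 hB
  have hdiff : ∀ n m : ℕ, n ≤ m →
      ‖J ((gaussDeriv β ^ l) (∑ k ∈ Finset.range n, p k)) -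
        J ((gaussDeriv β ^ l) (∑ k ∈ Finset.range m, p k))‖ ^ 2 ≤
        K * (∑' k, a k - ∑ k ∈ Finset.range n, a k) := by
    intro n m hnm
    -- Zeroing the first `n` levels keeps a level sequence, so the inverse inequality also applies
    -- to blocks of the sum.
    set p' : ℕ → Polynomial ℂ := fun k => if k < n then 0 else p k with hp'
    have hL : ∀ k, IsHermiteLevel J k (p' k) := by
      intro k
      by_cases hk : k < n
      · simp only [hp', if_pos hk]; exact isHermiteLevel_zero J k
      · simp only [hp', if_neg hk]; exact hp k
    have hs : ∑ k ∈ Finset.range m, p' k =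
        ∑ k ∈ Finset.range m, p k - ∑ k ∈ Finset.range n, p k := by
      rw [Finset.range_eq_Ico, Finset.range_eq_Ico, ← Finset.sum_Ico_consecutive p' n.zero_le hnm,
        ← Finset.sum_Ico_consecutive p n.zero_le hnm, add_sub_cancel_left,
        Finset.sum_eq_zero, zero_add]
      · exact Finset.sum_congr rfl fun k hk => if_neg (not_lt.2 (Finset.mem_Ico.1 hk).1)
      · exact fun k hk => if_pos (Finset.mem_Ico.1 hk).2
    have hsa : ∑ k ∈ Finset.range m, ((k : ℝ) + 1) ^ l * ‖J (p' k)‖ ^ 2 =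
        ∑ k ∈ Finset.range m, a k - ∑ k ∈ Finset.range n, a k := by
      rw [Finset.range_eq_Ico, Finset.range_eq_Ico, ← Finset.sum_Ico_consecutive _ n.zero_le hnm,
        ← Finset.sum_Ico_consecutive a n.zero_le hnm, add_sub_cancel_left,
        Finset.sum_eq_zero, zero_add]
      · refine Finset.sum_congr rfl fun k hk => ?_
        simp only [hp', ha, if_neg (not_lt.2 (Finset.mem_Ico.1 hk).1)]
      · intro k hk
        simp [hp', if_pos (Finset.mem_Ico.1 hk).2]
    have h := hJ.norm_gaussDeriv_pow_sum_sq_le hμ l hL m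
    rw [hs, hsa, map_sub, map_sub, norm_sub_rev] at h
    refine h.trans (mul_le_mul_of_nonneg_left ?_ hK0)
    exact sub_le_sub_right (hsum.sum_le_tsum _ fun k _ => ha0 k) _
  have hcauchy : CauchySeq fun M => J ((gaussDeriv β ^ l) (∑ n ∈ Finset.range M, p n)) := by
    refine cauchySeq_of_le_tendsto_0'
      (fun n => Real.sqrt (K * (∑' k, a k - ∑ k ∈ Finset.range n, a k))) (fun n m hnm => ?_) ?_
    · rw [dist_eq_norm]
      exact Real.le_sqrt_of_sq_le (hdiff n m hnm)
    · have h := (((tendsto_const_nhds (x := ∑' k, a k)).sub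
        hsum.hasSum.tendsto_sum_nat).const_mul K).sqrt
      simpa using h
  obtain ⟨G, hG⟩ := cauchySeq_tendsto_of_complete hcauchy
  refine ⟨G, hG, le_of_tendsto (hG.norm.pow 2) (Filter.Eventually.of_forall fun M => ?_)⟩
  exact (hJ.norm_gaussDeriv_pow_sum_sq_le hμ l hp M).trans
    (mul_le_mul_of_nonneg_left (hB M) hK0)

theorem enorm_sq_le_of_le_mul_rpow {E : Type*} [NormedAddCommGroup E] {v : E} {A : ℝ≥0}
    {I : ℝ≥0∞} (h : ‖v‖ₑ ≤ A * I ^ (1 / 2 : ℝ)) :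
    ENNReal.ofReal (‖v‖ ^ 2) ≤ (A : ℝ≥0∞) ^ 2 * I := by
  have e : (I ^ (1 / 2 : ℝ)) ^ 2 = I := by
    rw [← ENNReal.rpow_natCast, ← ENNReal.rpow_mul]
    norm_num
  calc ENNReal.ofReal (‖v‖ ^ 2) = ‖v‖ₑ ^ 2 := by
        rw [ENNReal.ofReal_pow (norm_nonneg _), ofReal_norm]
    _ ≤ (A * I ^ (1 / 2 : ℝ)) ^ 2 := by gcongr
    _ = _ := by rw [mul_pow, e]

/-- The derivative of the truncation error as a limit of derivatives of Hermite sums. -/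
theorem exists_limit_deriv_sub_hermiteProj {μ β : ℝ} (hμ : -(1 / 2) < μ) (hβ : 0 < β) (l : ℕ)
    {A : ℝ≥0} {u : Lp ℂ 2 (weight μ)} {F : ℝ → ℝ≥0∞} {N : ℕ} (hN : 1 ≤ N)
    (hF : AEMeasurable F (volume.restrict (Ioi (N : ℝ))))
    (hu : ∀ n : ℕ, N ≤ n → ‖u - hermiteProj μ β n u‖ₑ ≤
      A * (∫⁻ x in Ioi (n : ℝ), F x) ^ (1 / 2 : ℝ))
    (hfin : ∫⁻ x in Ioi (N : ℝ), F x * ENNReal.ofReal (x ^ l) ≠ ∞) :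
    ∃ (q : ℕ → Polynomial ℂ) (G : Lp ℂ 2 (weight μ)),
      Filter.Tendsto (fun n => hermiteMap hμ hβ (q n)) Filter.atTop
        (nhds (u - hermiteProj μ β N u)) ∧
      Filter.Tendsto (fun n => hermiteMap hμ hβ ((gaussDeriv β ^ l) (q n))) Filter.atTop
        (nhds G) ∧
      ENNReal.ofReal (‖G‖ ^ 2) ≤ ENNReal.ofReal (derivConst μ l * (β ^ 2) ^ l) *
        ((A : ℝ≥0∞) ^ 2 * (3 ^ l * ∫⁻ x in Ioi (N : ℝ), F x * ENNReal.ofReal (x ^ l))) := by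
  obtain ⟨p, hp, hp0, hp1⟩ := exists_isHermiteLevel_increments hμ hβ N u
  set J := hermiteMap hμ hβ with hJ
  set r : ℕ → ℝ := fun n => ‖u - hermiteProj μ β n u‖ ^ 2 with hr
  set I : ℝ≥0∞ := ∫⁻ x in Ioi (N : ℝ), F x * ENNReal.ofReal (x ^ l) with hI
  have hrb : ∀ n, N ≤ n → ENNReal.ofReal (r n) ≤
      (A : ℝ≥0∞) ^ 2 * ∫⁻ x in Ioi (n : ℝ), F x := fun n hn =>
    enorm_sq_le_of_le_mul_rpow (hu n hn)
  set T : ℕ → ℝ := fun M => ∑ n ∈ Finset.range M, ((n : ℝ) + 1) ^ l * ‖J (p n)‖ ^ 2 with hT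
  have hTmono : Monotone T := fun M M' h =>
    Finset.sum_le_sum_of_subset_of_nonneg (Finset.range_mono h) fun _ _ _ => by positivity
  have hTN : T (N + 1) = 0 := Finset.sum_eq_zero fun n hn => by
    rw [hp0 n (Nat.lt_succ_iff.1 (Finset.mem_range.1 hn))]
    simp
  have hTs : ∀ n, N ≤ n →
      T (n + 1 + 1) = T (n + 1) + ((n : ℝ) + 2) ^ l * (r n - r (n + 1)) := by
    intro n hn
    rw [hT]
    simp only
    rw [Finset.sum_range_succ _ (n + 1), hp1 n hn, norm_hermiteProj_succ_sub_sq hμ hβ]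
    push_cast
    ring
  set B : ℝ≥0∞ := (A : ℝ≥0∞) ^ 2 * (3 ^ l * I) with hBdef
  have hBfin : B ≠ ∞ :=
    ENNReal.mul_ne_top (by simp) (ENNReal.mul_ne_top (by simp) hfin)
  have hTB : ∀ M, T M ≤ B.toReal := by
    intro M
    refine (hTmono (show M ≤ (N + M) + 1 by omega)).trans ?_
    rw [← ENNReal.ofReal_le_iff_le_toReal hBfin]
    exact ofReal_abel_sum_le_pow (S := fun n => T (n + 1)) hN hF (fun n => by positivity) hrb hTN
      hTs (Nat.le_add_right N M)
  obtain ⟨G, hG, hGn⟩ := exists_tendsto_gaussDeriv_partialSum hμ hβ l hp hTB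
  refine ⟨fun M => ∑ n ∈ Finset.range M, p n, G, ?_, hG, ?_⟩
  · rw [← Filter.tendsto_add_atTop_iff_nat 1]
    have hsum : ∀ M, N ≤ M → J (∑ n ∈ Finset.range (M + 1), p n) =
        hermiteProj μ β M u - hermiteProj μ β N u := by
      intro M hM
      induction M, hM using Nat.le_induction with
      | base =>
        rw [Finset.sum_eq_zero fun n hn => hp0 n (Nat.lt_succ_iff.1 (Finset.mem_range.1 hn)),
          map_zero, sub_self]
      | succ M hM ih =>
        rw [Finset.sum_range_succ, map_add, ih, hp1 M hM]
        abel
    -- Since `x^l ≥ 1` for `x > N ≥ 1`, the unweighted tails are finite and tend to `0`. Thus the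
    -- projections converge to `u` by the assumed error bound, without using completeness of the
    -- Hermite functions.
    have hFfin : ∫⁻ x in Ioi (N : ℝ), F x ≠ ∞ := by
      refine ne_top_of_le_ne_top hfin (setLIntegral_mono' measurableSet_Ioi fun x hx => ?_)
      have hx1 : 1 ≤ x := le_trans (by exact_mod_cast hN) (le_of_lt hx)
      refine le_mul_of_one_le_right' ?_
      rw [ENNReal.one_le_ofReal]
      exact one_le_pow₀ hx1
    have hr0 : Filter.Tendsto (fun n => ENNReal.ofReal (r n)) Filter.atTop (nhds 0) := by
      have h1 := ENNReal.Tendsto.const_mul (a := (A : ℝ≥0∞) ^ 2)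
        (tendsto_setLIntegral_Ioi_atTop hF hFfin) (Or.inr (by simp))
      rw [mul_zero] at h1
      refine tendsto_of_tendsto_of_tendsto_of_le_of_le' tendsto_const_nhds h1
        (Filter.Eventually.of_forall fun _ => zero_le) ?_
      filter_upwards [Filter.eventually_ge_atTop N] with n hn
      exact hrb n hn
    have hr1 : Filter.Tendsto r Filter.atTop (nhds 0) := by
      have h := (ENNReal.tendsto_toReal ENNReal.zero_ne_top).comp hr0
      refine h.congr fun n => ?_
      exact ENNReal.toReal_ofReal (by positivity)
    rw [tendsto_iff_norm_sub_tendsto_zero]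
    have hr2 := hr1.sqrt
    rw [Real.sqrt_zero] at hr2
    refine hr2.congr' ?_
    filter_upwards [Filter.eventually_ge_atTop N] with M hM
    rw [hsum M hM, hr, Real.sqrt_sq (norm_nonneg _), ← norm_neg]
    congr 1
    abel
  · calc ENNReal.ofReal (‖G‖ ^ 2)
        ≤ ENNReal.ofReal (derivConst μ l * (β ^ 2) ^ l * B.toReal) :=
          ENNReal.ofReal_le_ofReal hGn
      _ = _ := by
          rw [ENNReal.ofReal_mul (mul_nonneg (derivConst_pos hμ l).le (by positivity)),
            ENNReal.ofReal_toReal hBfin]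

theorem hasWeakDeriv_zero (Ω : Set ℝ) (l : ℕ) {v : ℝ → ℂ} (hv : v =ᵐ[volume] 0) :
    HasWeakDeriv Ω l v 0 := by
  have h0 : LocallyIntegrableOn (0 : ℝ → ℂ) Ω := locallyIntegrableOn_zero
  refine ⟨h0.congr (ae_restrict_of_ae hv.symm), h0, fun φ _ _ _ => ?_⟩
  rw [integral_congr_ae (g := 0)]
  · simp
  · filter_upwards [hv] with x hx
    simp [hx]

end

/-! ### The main estimate. -/

theorem theorem5p1 (μ : ℝ) (hμ : -(1 / 2) < μ) (l : ℕ) :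
    ∃ C : ℝ≥0, ∀ (β : ℝ) (A : ℝ≥0) (u : Lp ℂ 2 (weight μ)) (f : ℝ → ℂ) (N : ℕ),
      0 < β → 1 ≤ N → AEMeasurable f (volume.restrict (Ioi (N : ℝ))) →
      (∀ n : ℕ, N ≤ n →
        eLpNorm ⇑(u - hermiteProj μ β n u) 2 (weight μ) ≤
          A * (∫⁻ x in Ioi (n : ℝ), ‖f x‖ₑ ^ 2) ^ (1 / 2 : ℝ)) →
      (∀ g : ℝ → ℂ, HasWeakDeriv {0}ᶜ l ⇑(u - hermiteProj μ β N u) g →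
        eLpNorm g 2 (weight μ) ≤
          C * A * ENNReal.ofReal (β ^ l) *
            (∫⁻ x in Ioi (N : ℝ), ‖f x‖ₑ ^ 2 * ENNReal.ofReal (x ^ l)) ^ (1 / 2 : ℝ)) ∧
      ((∫⁻ x in Ioi (N : ℝ), ‖f x‖ₑ ^ 2 * ENNReal.ofReal (x ^ l)) < ∞ →
        ∃ g : ℝ → ℂ, HasWeakDeriv {0}ᶜ l ⇑(u - hermiteProj μ β N u) g ∧
          (μ < 1 / 2 → HasWeakDeriv univ l ⇑(u - hermiteProj μ β N u) g)) := by
  have hK := derivConst_pos hμ l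
  set C : ℝ≥0 := Real.toNNReal (Real.sqrt (derivConst μ l * 3 ^ l)) with hC
  -- Positivity matters because `0 * ∞ = 0`: when the integral diverges the right side must really
  -- be `∞`.
  have hC0 : C ≠ 0 := by
    rw [hC, ne_eq, Real.toNNReal_eq_zero, not_le]
    positivity
  have hC2 : (C : ℝ≥0∞) ^ 2 = ENNReal.ofReal (derivConst μ l) * 3 ^ l := by
    rw [hC, ← ENNReal.ofReal, ← ENNReal.ofReal_pow (Real.sqrt_nonneg _),
      Real.sq_sqrt (by positivity), ENNReal.ofReal_mul hK.le, ENNReal.ofReal_pow (by norm_num),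
      ENNReal.ofReal_ofNat]
  refine ⟨C, fun β A u f N hβ hN hf hu => ?_⟩
  set I : ℝ≥0∞ := ∫⁻ x in Ioi (N : ℝ), ‖f x‖ₑ ^ 2 * ENNReal.ofReal (x ^ l) with hI
  have hF : AEMeasurable (fun x => ‖f x‖ₑ ^ 2) (volume.restrict (Ioi (N : ℝ))) :=
    hf.enorm.pow_const 2
  have hu' : ∀ n : ℕ, N ≤ n → ‖u - hermiteProj μ β n u‖ₑ ≤
      A * (∫⁻ x in Ioi (n : ℝ), ‖f x‖ₑ ^ 2) ^ (1 / 2 : ℝ) := fun n hn => by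
    rw [Lp.enorm_def]
    exact hu n hn
  refine ⟨fun g hg => ?_, fun hfin => ?_⟩
  · by_cases hfin : I = ∞
    -- For `A = 0` the right side is `0` even if the integral diverges; then the error itself
    -- vanishes, and so does its weak derivative.
    · rcases eq_or_ne A 0 with rfl | hA
      · have h0 : u - hermiteProj μ β N u = 0 := by
          have h := hu' N le_rfl
          rw [ENNReal.coe_zero, zero_mul, nonpos_iff_eq_zero, enorm_eq_zero] at h
          exact h
        rw [h0] at hg
        have hv := (volume_absolutelyContinuous_weight μ).ae_eq (Lp.coeFn_zero ℂ 2 (weight μ))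
        rw [eLpNorm_congr_ae (hg.ae_eq_weight (μ := μ) (hasWeakDeriv_zero _ l hv)), eLpNorm_zero]
        exact zero_le
      · rw [hfin, ENNReal.top_rpow_of_pos (by norm_num), ENNReal.mul_top]
        · exact le_top
        · refine mul_ne_zero (mul_ne_zero (by exact_mod_cast hC0) (by exact_mod_cast hA)) ?_
          rw [ne_eq, ENNReal.ofReal_eq_zero, not_le]
          positivity
    · obtain ⟨q, G, hq, hG, hGn⟩ :=
        exists_limit_deriv_sub_hermiteProj hμ hβ l hN hF hu' hfin
      have hw := hasWeakDeriv_of_tendsto_hermiteMap hμ hβ isOpen_compl_singleton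
        (locallyIntegrableOn_rpow_compl_zero _) l hq hG
      rw [eLpNorm_congr_ae (hg.ae_eq_weight (μ := μ) hw), ← Lp.enorm_def,
        ← ENNReal.pow_le_pow_left_iff two_ne_zero]
      rw [ENNReal.ofReal_pow (norm_nonneg _), ofReal_norm] at hGn
      refine hGn.trans (le_of_eq ?_)
      have e : (I ^ (1 / 2 : ℝ)) ^ 2 = I := by
        rw [← ENNReal.rpow_natCast, ← ENNReal.rpow_mul]
        norm_num
      rw [mul_pow, mul_pow, mul_pow, e, hC2, ENNReal.ofReal_mul hK.le, ← hI,
        ← ENNReal.ofReal_pow (by positivity), ← pow_mul, ← pow_mul, mul_comm 2 l]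
      ring
  · obtain ⟨q, G, hq, hG, -⟩ :=
      exists_limit_deriv_sub_hermiteProj hμ hβ l hN hF hu' hfin.ne
    exact ⟨G, hasWeakDeriv_of_tendsto_hermiteMap hμ hβ isOpen_compl_singleton
      (locallyIntegrableOn_rpow_compl_zero _) l hq hG, fun h =>
      hasWeakDeriv_of_tendsto_hermiteMap hμ hβ isOpen_univ (locallyIntegrableOn_rpow_univ h) l hq
        hG⟩
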